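/- Let $p>2$ be a prime, $F$ a finite extension of $\mathbb Q_p$ with uniformizer $\varpi$, normalized valuation $v$ (also extended to $E$; $v(0)=\infty$), ring of integers $\mathcal O_F$ and residue field of cardinality $q$. Let $E/F$ be the unramified quadratic extension, $x\mapsto\bar x$ its nontrivial automorphism, $\eta(x)=(-1)^{v(x)}$ and $|x|_F=q^{-v(x)}$ for $x\in F^\times$. Let $S_2(F)=\{g\in \mathrm{GL}_2(E): g\bar g=1\}$ and, for an integer $r\ge 0$, $K'_{S,\le r}=\{g\in S_2(F): \varpi^r g\in \mathrm{Mat}_2(\mathcal O_E)\}$. For $\gamma\in S_2(F)$, a column vector $\mathbf u\in F^2$ and a row vector $\mathbf v^\top$ over $F$, put $$\mathrm{Orb}((\gamma,\mathbf u,\mathbf v^\top),\mathbf 1_{K'_{S,\le r}},s)=\int_{\mathrm{GL}_2(F)}\mathbf 1_{K'_{S,\le r}}(h\gamma h^{-1})\,\mathbf 1_{\mathcal O_F^2\times(\mathcal O_F^2)^\vee}(h\mathbf u,\mathbf v^\top h^{-1})\,\eta(\det h)\,|\det h|_F^{-s}\,dh,$$ where $dh$ is the Haar measure giving $\mathrm{GL}_2(\mathcal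 O_F)$ volume $1$, and let $\partial\mathrm{Orb}$ denote its derivative in $s$ at $s=0$. Consider triples $(\gamma,\mathbf u,\mathbf v^\top)=\left(\begin{pmatrix}a&b\\c&d\end{pmatrix},\begin{pmatrix}0\\1\end{pmatrix},\begin{pmatrix}0&e\end{pmatrix}\right)$ with $\gamma\in S_2(F)$, $e\in F$, $b,c,e\ne 0$ and $v(1-a\bar a)$ odd (equivalently, the triple is regular semisimple and matches the non-split unitary group). Then $v(b)+v(c)$ is odd and positive, and $v(d-a)\in\{0,1,2,\dots\}\cup\{\infty\}$. Write $\partial\mathrm{Orb}(r,v(b),v(c),v(e),v(d-a))$ for $\partial\mathrm{Orb}((\gamma,\mathbf u,\mathbf v^\top),\mathbf 1_{K'_{S,\le r}})$ for any such triple with these valuations; the theorem includes that the identity below holds whichever triples are used. Put $$n_1=\min\bigl(2v(e),\,v(b)+v(c)+2r,\,2v(d-a)+2r\bigr),\qquad n_2=2v(e)+v(b)+v(c)+2r-n_1,$$ $$\mathrm{GK}(r,v(b),v(c),v(e),v(d-a))=\begin{cases}\displaystyle\sum_{j=0}^{(n_1-1)/2}(n_1+n_2-4j)q^j & n_1\text{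 odd},\\[2ex] \displaystyle\frac{n_2-n_1+1}{2}\,q^{n_1/2}+\sum_{j=0}^{n_1/2-1}(n_1+n_2-4j)q^j & n_1\text{ even}.\end{cases}$$ Theorem. If $r\ge 0$ and $v(e)\ge 0$, the integrals defining the two orbital integrals involved (at $v(e)$ and at $v(e)-1$) converge absolutely for every $s\in\mathbb C$ and are differentiable in $s$ at $s=0$, and $$\frac{(-1)^{r+v(c)}}{\log q}\Bigl(\partial\mathrm{Orb}(r,v(b),v(c),v(e),v(d-a))+\partial\mathrm{Orb}(r,v(b),v(c),v(e)-1,v(d-a))\Bigr)=\mathrm{GK}(r,v(b),v(c),v(e),v(d-a)).$$ -/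

import Mathlib

open MeasureTheory

noncomputable section

namespace SemiLieAFL

section LocalField

variable {F : Type*} [NormedField F]

/-- `ϖ` generates the maximal ideal `{x | ‖x‖ < 1}` of the ring of integers `{x | ‖x‖ ≤ 1}`. -/
def IsUniformizer (ϖ : F) : Prop :=
  ϖ ≠ 0 ∧ ‖ϖ‖ < 1 ∧ ∀ x : F, ‖x‖ < 1 → ‖x‖ ≤ ‖ϖ‖

/-- The cardinality of the residue field of `F`. -/
def residueCard (F : Type*) [NormedField F] [IsUltrametricDist F] : ℕ :=
  Nat.card (IsLocalRing.ResidueField (NormedField.valuation (K := F)).valuationSubring)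

/-- The normalized valuation `v` of a nonzero element `x` of `F` or of an unramified extension
of `F`, i.e. the integer `v` with `‖x‖ = ‖ϖ‖ ^ v`. (Only used at nonzero elements.) -/
def ord {E : Type*} [NormedField E] (ϖ : F) (x : E) : ℤ :=
  ⌊Real.logb ‖ϖ‖ ‖x‖⌋

open Classical in
/-- The normalized valuation, with the convention `v 0 = ∞`. -/
def ordTop {E : Type*} [NormedField E] (ϖ : F) (x : E) : WithTop ℤ :=
  if x = 0 then ⊤ else (ord ϖ x : WithTop ℤ)

/-- The quadratic character of `Fˣ` attached to the unramified quadratic extension of `F`. -/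
def eta (ϖ : F) (x : F) : ℂ :=
  (-1) ^ ord ϖ x

/-- The normalized absolute value of `F` at a nonzero element `x`, so that `|ϖ| = 1 / q`. -/
def normAbs [IsUltrametricDist F] (ϖ : F) (x : F) : ℝ :=
  (residueCard F : ℝ) ^ (-ord ϖ x)

/-- The maximal compact subgroup `GL_n(𝓞_F)` of `GL_n(F)`. -/
def integralGL (n : ℕ) (F : Type*) [NormedField F] :
    Set (Matrix.GeneralLinearGroup (Fin n) F) :=
  {h | ∀ i j, ‖(h : Matrix (Fin n) (Fin n) F) i j‖ ≤ 1 ∧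
    ‖((h⁻¹ : Matrix.GeneralLinearGroup (Fin n) F) : Matrix (Fin n) (Fin n) F) i j‖ ≤ 1}

variable {E : Type*} [NormedField E] [NormedAlgebra F E]

/-- `E / F` is an unramified quadratic extension: it has degree two and ramification index one
(the residue fields are finite, so there is no separability condition). -/
def IsUnramifiedQuadratic (F E : Type*) [NormedField F] [NormedField E] [NormedAlgebra F E] :
    Prop :=
  Module.finrank F E = 2 ∧ ∀ x : E, ∃ y : F, ‖y‖ = ‖x‖

/-- The symmetric space `S_n(F)`: the `g` in `GL_n(E)` with `g * σ(g) = 1`. -/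
def symmetricSpace {n : ℕ} (σ : E ≃ₐ[F] E) : Set (Matrix (Fin n) (Fin n) E) :=
  {g | g * g.map σ = 1}

/-- The set `K'_{S, ≤ r}` of all `g` in `S_n(F)` such that `ϖ ^ r * g` has entries in `𝓞_E`. -/
def boundedSymmetric {n : ℕ} (σ : E ≃ₐ[F] E) (ϖ : F) (r : ℕ) :
    Set (Matrix (Fin n) (Fin n) E) :=
  {g | g ∈ symmetricSpace σ ∧ ∀ i j, ‖algebraMap F E ϖ ^ r * g i j‖ ≤ 1}

/-- The test function `1_{K'_{S, ≤ r}}`. -/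
def testFn {n : ℕ} (σ : E ≃ₐ[F] E) (ϖ : F) (r : ℕ) : Matrix (Fin n) (Fin n) E → ℂ :=
  Set.indicator (boundedSymmetric σ ϖ r) 1

/-- The indicator function of `𝓞_F^n × (𝓞_F^n)^∨`. -/
def latticeIndicator {n : ℕ} (w : (Fin n → F) × (Fin n → F)) : ℂ :=
  Set.indicator {w : (Fin n → F) × (Fin n → F) | (∀ i, ‖w.1 i‖ ≤ 1) ∧ ∀ i, ‖w.2 i‖ ≤ 1} 1 w

/-- The conjugate `h γ h⁻¹` of a matrix over `E` by an element of `GL_n(F)`. -/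
def conj {n : ℕ} (h : Matrix.GeneralLinearGroup (Fin n) F) (γ : Matrix (Fin n) (Fin n) E) :
    Matrix (Fin n) (Fin n) E :=
  (h : Matrix (Fin n) (Fin n) F).map (algebraMap F E) * γ *
    ((h⁻¹ : Matrix.GeneralLinearGroup (Fin n) F) : Matrix (Fin n) (Fin n) F).map (algebraMap F E)

/-- The integrand of the weighted orbital integral: the test function `φ ⊗ 1_{𝓞^n × (𝓞^n)^∨}`
evaluated at `h • (γ, u, vᵀ) = (h γ h⁻¹, h u, vᵀ h⁻¹)`, weighted by `η(det h) |det h|^{-s}`. -/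
def orbIntegrand [IsUltrametricDist F] {n : ℕ} (ϖ : F) (φ : Matrix (Fin n) (Fin n) E → ℂ)
    (γ : Matrix (Fin n) (Fin n) E) (u v : Fin n → F) (s : ℂ)
    (h : Matrix.GeneralLinearGroup (Fin n) F) : ℂ :=
  φ (conj h γ) *
    latticeIndicator (Matrix.mulVec (h : Matrix (Fin n) (Fin n) F) u,
      Matrix.vecMul v
        ((h⁻¹ : Matrix.GeneralLinearGroup (Fin n) F) : Matrix (Fin n) (Fin n) F)) *
    eta ϖ (h : Matrix (Fin n) (Fin n) F).det *
    ((normAbs ϖ (h : Matrix (Fin n) (Fin n) F).det : ℝ) : ℂ) ^ (-s)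

/-- The weighted orbital integral `Orb((γ, u, vᵀ), φ ⊗ 1_{𝓞^n × (𝓞^n)^∨}, s)`. -/
def weightedOrb [IsUltrametricDist F] {n : ℕ}
    [MeasurableSpace (Matrix.GeneralLinearGroup (Fin n) F)]
    (μ : Measure (Matrix.GeneralLinearGroup (Fin n) F)) (ϖ : F)
    (φ : Matrix (Fin n) (Fin n) E → ℂ) (γ : Matrix (Fin n) (Fin n) E) (u v : Fin n → F)
    (s : ℂ) : ℂ :=
  ∫ h, orbIntegrand ϖ φ γ u v s h ∂μ

/-- `∂Orb((γ, u, vᵀ), φ)`, the derivative of the weighted orbital integral at `s = 0`. -/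
def derivOrb [IsUltrametricDist F] {n : ℕ}
    [MeasurableSpace (Matrix.GeneralLinearGroup (Fin n) F)]
    (μ : Measure (Matrix.GeneralLinearGroup (Fin n) F)) (ϖ : F)
    (φ : Matrix (Fin n) (Fin n) E → ℂ) (γ : Matrix (Fin n) (Fin n) E) (u v : Fin n → F) : ℂ :=
  deriv (weightedOrb μ ϖ φ γ u v) 0

/-- The parameters of an orbit representative
`(γ, u, vᵀ) = (!![a, b; c, d], (0, 1)ᵀ, (0, e))`: the matrix `γ` lies in `S_2(F)`, the triple is
regular semisimple, and it is of the type that matches the non-split unitary group. -/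
structure IsNonsplitRep (σ : E ≃ₐ[F] E) (ϖ : F) (a b c d : E) (e : F) : Prop where
  mem_symmetricSpace : !![a, b; c, d] ∈ symmetricSpace σ
  b_ne_zero : b ≠ 0
  c_ne_zero : c ≠ 0
  e_ne_zero : e ≠ 0
  odd_ord : Odd (ord ϖ (1 - a * σ a))

end LocalField

/-- The right-hand side of the Gross-Keating formula for `0 ≤ n₁ ≤ n₂`. -/
def grossKeating (q : ℕ) (n₁ n₂ : ℤ) : ℚ :=
  if Odd n₁ then
    ∑ j ∈ Finset.Icc (0 : ℤ) ((n₁ - 1) / 2), (n₁ + n₂ - 4 * j : ℚ) * (q : ℚ) ^ j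
  else
    (n₂ - n₁ + 1 : ℚ) / 2 * (q : ℚ) ^ (n₁ / 2) +
      ∑ j ∈ Finset.Icc (0 : ℤ) (n₁ / 2 - 1), (n₁ + n₂ - 4 * j : ℚ) * (q : ℚ) ^ j

/-- `n₁ = min(2 v(e), v(b) + v(c) + 2 r, 2 v(d - a) + 2 r)`, where `v(d - a)` may be infinite. -/
def gkIndex (r : ℕ) (vb vc ve : ℤ) (vda : WithTop ℤ) : ℤ :=
  match vda with
  | none => min (2 * ve) (vb + vc + 2 * r)
  | some w => min (min (2 * ve) (vb + vc + 2 * r)) (2 * w + 2 * r)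

/-- The quantity `GK(r, v(b), v(c), v(e), v(d - a))`. -/
def GK (q r : ℕ) (vb vc ve : ℤ) (vda : WithTop ℤ) : ℚ :=
  grossKeating q (gkIndex r vb vc ve vda)
    (2 * ve + vb + vc + 2 * r - gkIndex r vb vc ve vda)

end SemiLieAFL

end

/-!
By the Iwasawa decomposition every `h` in `GL₂(F)` is `k * !![ϖ ^ m, x; 0, ϖ ^ n]` with `k` in
`GL₂(𝓞_F)`, and the integrand only depends on the upper triangular factor. The conditions on
`v ᵀ h⁻¹` and `h u` bound `n` and `x`. The relation `γ * σ(γ) = 1` makes `κ = c / b` and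
`τ = (d - a) / b` elements of `F`, and the upper right entry of `h γ h⁻¹` is
`b * (ϖ ^ (2 * m) + τ * ϖ ^ m * x - κ * x ^ 2) / ϖ ^ (m + n)`, so integrality of `ϖ ^ r * h γ h⁻¹`
requires this quadratic polynomial in `x` to be small. If `‖τ‖ ^ 2 > ‖κ‖` it splits over `F` by
Hensel's lemma and `x` must be close to one of two roots; otherwise the oddness of
`v(1 - a * σ a) = v(b) + v(c)` prevents cancellation between its terms. In both cases the
admissible `x` form an explicit finite union of balls. The orbital integral is then a finite sum
over `(m, n)` of a number of classes times `(-1) ^ (m + n) * q ^ (s * (m + n))`, whose derivative at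
`0` is an alternating sum. Each row of fixed `n` is elementary to sum, and adding the sums for
`v(e)` and `v(e) - 1` pairs consecutive rows so that the signs cancel and the Gross-Keating
polynomial remains.
-/

open MeasureTheory

noncomputable section

namespace SemiLieAFL

section Uniformizer

variable {F : Type*} [NormedField F] {ϖ : F}

lemma IsUniformizer.norm_pos (h : IsUniformizer ϖ) : 0 < ‖ϖ‖ := norm_pos_iff.2 h.1

lemma IsUniformizer.zpow_le_zpow (h : IsUniformizer ϖ) {i j : ℤ} :
    ‖ϖ‖ ^ i ≤ ‖ϖ‖ ^ j ↔ j ≤ i :=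
  zpow_le_zpow_iff_right_of_lt_one₀ h.norm_pos h.2.1

lemma IsUniformizer.zpow_lt_zpow (h : IsUniformizer ϖ) {i j : ℤ} :
    ‖ϖ‖ ^ i < ‖ϖ‖ ^ j ↔ j < i :=
  zpow_lt_zpow_iff_right_of_lt_one₀ h.norm_pos h.2.1

lemma IsUniformizer.zpow_inj (h : IsUniformizer ϖ) {i j : ℤ} :
    ‖ϖ‖ ^ i = ‖ϖ‖ ^ j ↔ i = j :=
  (zpow_right_injective₀ h.norm_pos h.2.1.ne).eq_iff

lemma IsUniformizer.zpow_le_one (h : IsUniformizer ϖ) {i : ℤ} : ‖ϖ‖ ^ i ≤ 1 ↔ 0 ≤ i := by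
  rw [← h.zpow_le_zpow, zpow_zero]

lemma IsUniformizer.zpow_mul_zpow (h : IsUniformizer ϖ) (i j : ℤ) :
    ‖ϖ‖ ^ i * ‖ϖ‖ ^ j = ‖ϖ‖ ^ (i + j) :=
  (zpow_add₀ h.norm_pos.ne' i j).symm

lemma IsUniformizer.exists_norm_eq_zpow (h : IsUniformizer ϖ) {x : F} (hx : x ≠ 0) :
    ∃ k : ℤ, ‖x‖ = ‖ϖ‖ ^ k := by
  obtain ⟨k, hk, hk'⟩ :=
    exists_mem_Ioc_zpow (norm_pos_iff.2 hx) ((one_lt_inv₀ h.norm_pos).2 h.2.1)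
  rw [inv_zpow'] at hk hk'
  refine ⟨-(k + 1), hk'.antisymm (not_lt.1 fun hlt => hk.not_ge ?_)⟩
  have scaled_lt_one : ‖x * ϖ ^ (k + 1)‖ < 1 := by
    rw [norm_mul, norm_zpow]
    calc ‖x‖ * ‖ϖ‖ ^ (k + 1) < ‖ϖ‖ ^ (-(k + 1)) * ‖ϖ‖ ^ (k + 1) :=
          mul_lt_mul_of_pos_right hlt (zpow_pos h.norm_pos _)
      _ = 1 := by rw [h.zpow_mul_zpow, neg_add_cancel, zpow_zero]
  have scaled_le : ‖x‖ * ‖ϖ‖ ^ (k + 1) ≤ ‖ϖ‖ := by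
    simpa only [norm_mul, norm_zpow] using h.2.2 _ scaled_lt_one
  calc ‖x‖ = ‖x‖ * ‖ϖ‖ ^ (k + 1) * ‖ϖ‖ ^ (-(k + 1)) := by
        rw [mul_assoc, h.zpow_mul_zpow, add_neg_cancel, zpow_zero, mul_one]
    _ ≤ ‖ϖ‖ ^ (1 : ℤ) * ‖ϖ‖ ^ (-(k + 1)) := by
        rw [zpow_one]
        exact mul_le_mul_of_nonneg_right scaled_le (zpow_nonneg (norm_nonneg ϖ) _)
    _ = ‖ϖ‖ ^ (-k) := by rw [h.zpow_mul_zpow]; ring_nf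

variable {E : Type*} [NormedField E]

lemma IsUniformizer.ord_eq_of_norm_eq (h : IsUniformizer ϖ) {x : E} {k : ℤ}
    (hx : ‖x‖ = ‖ϖ‖ ^ k) : ord ϖ x = k := by
  rw [ord, hx, ← Real.rpow_intCast, Real.logb_rpow h.norm_pos h.2.1.ne, Int.floor_intCast]

lemma IsUniformizer.norm_eq_zpow_ord_of_norm_eq (h : IsUniformizer ϖ) {x : E} (hx : x ≠ 0)
    {y : F} (hy : ‖y‖ = ‖x‖) : ‖x‖ = ‖ϖ‖ ^ ord ϖ x := by
  obtain ⟨k, hk⟩ := h.exists_norm_eq_zpow (norm_pos_iff.1 (hy ▸ norm_pos_iff.2 hx))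
  rw [h.ord_eq_of_norm_eq (hy.symm.trans hk), ← hy, hk]

lemma IsUniformizer.norm_eq_zpow_ord (h : IsUniformizer ϖ) {x : F} (hx : x ≠ 0) :
    ‖x‖ = ‖ϖ‖ ^ ord ϖ x :=
  h.norm_eq_zpow_ord_of_norm_eq hx rfl

end Uniformizer

section Ultrametric

variable {F : Type*} [NormedField F] [IsUltrametricDist F] {x y : F}

lemma norm_add_le_of_norm_le {ρ : ℝ} (hx : ‖x‖ ≤ ρ) (hy : ‖y‖ ≤ ρ) : ‖x + y‖ ≤ ρ :=
  (IsUltrametricDist.norm_add_le_max x y).trans (max_le hx hy)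

lemma norm_sub_le_of_norm_le {ρ : ℝ} (hx : ‖x‖ ≤ ρ) (hy : ‖y‖ ≤ ρ) : ‖x - y‖ ≤ ρ :=
  sub_eq_add_neg x y ▸ norm_add_le_of_norm_le hx (by rwa [norm_neg])

lemma norm_add_le_iff_of_norm_le {ρ : ℝ} (hx : ‖x‖ ≤ ρ) : ‖x + y‖ ≤ ρ ↔ ‖y‖ ≤ ρ :=
  ⟨fun h => by simpa using norm_sub_le_of_norm_le h hx, norm_add_le_of_norm_le hx⟩

lemma norm_sub_le_iff_of_norm_le {ρ : ℝ} (hx : ‖x‖ ≤ ρ) : ‖x - y‖ ≤ ρ ↔ ‖y‖ ≤ ρ := by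
  rw [sub_eq_add_neg, norm_add_le_iff_of_norm_le hx, norm_neg]

lemma norm_add_eq_of_lt (h : ‖x‖ < ‖y‖) : ‖x + y‖ = ‖y‖ := by
  rw [IsUltrametricDist.norm_add_eq_max_of_norm_ne_norm h.ne, max_eq_right h.le]

lemma norm_sub_eq_of_lt (h : ‖x‖ < ‖y‖) : ‖x - y‖ = ‖y‖ := by
  rw [sub_eq_add_neg, norm_add_eq_of_lt (by rwa [norm_neg]), norm_neg]

end Ultrametric

section BallPartition

variable {α : Type*} [PseudoMetricSpace α] {ρ ρ' : ℝ} {N N' : ℕ} {X Y : Set α}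

/-- The set `X` is the disjoint union of `N` closed balls of radius `ρ`. In an ultrametric space
this says that `X` consists of `N` classes for the relation `dist x y ≤ ρ`. -/
def HasBallPartition (ρ : ℝ) (N : ℕ) (X : Set α) : Prop :=
  ∃ f : Fin N → α, Pairwise (Function.onFun Disjoint fun i => Metric.closedBall (f i) ρ) ∧
    X = ⋃ i, Metric.closedBall (f i) ρ

lemma hasBallPartition_iUnion {ι : Type*} [Finite ι] {f : ι → α}
    (hf : Pairwise (Function.onFun Disjoint fun i => Metric.closedBall (f i) ρ)) :
    HasBallPartition ρ (Nat.card ι) (⋃ i, Metric.closedBall (f i) ρ) :=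
  ⟨f ∘ (Finite.equivFin ι).symm, hf.comp_of_injective (Finite.equivFin ι).symm.injective,
    ((Finite.equivFin ι).symm.surjective.iUnion_comp fun i => Metric.closedBall (f i) ρ).symm⟩

lemma hasBallPartition_zero_iff : HasBallPartition ρ 0 X ↔ X = ∅ :=
  ⟨fun ⟨_, _, hX⟩ => hX.trans (Set.iUnion_of_empty _),
    fun hX => ⟨Fin.elim0, fun i => i.elim0, hX.trans (Set.iUnion_of_empty _).symm⟩⟩

lemma hasBallPartition_closedBall_self (x : α) :
    HasBallPartition ρ 1 (Metric.closedBall x ρ) :=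
  ⟨fun _ => x, fun _ _ hij => (hij (Subsingleton.elim _ _)).elim, (Set.iUnion_const _).symm⟩

lemma HasBallPartition.union (hX : HasBallPartition ρ N X) (hY : HasBallPartition ρ N' Y)
    (hXY : Disjoint X Y) : HasBallPartition ρ (N + N') (X ∪ Y) := by
  obtain ⟨f, hf, rfl⟩ := hX
  obtain ⟨g, hg, rfl⟩ := hY
  have hfg : ∀ i j, Disjoint (Metric.closedBall (f i) ρ) (Metric.closedBall (g j) ρ) :=
    fun i j => hXY.mono (Set.subset_iUnion_of_subset i subset_rfl)
      (Set.subset_iUnion_of_subset j subset_rfl)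
  have disjoint_balls : Pairwise
      (Function.onFun Disjoint fun i => Metric.closedBall (Sum.elim f g i) ρ) := by
    rintro (i | i) (j | j) hij
    · exact hf fun h => hij (congrArg _ h)
    · exact hfg i j
    · exact (hfg j i).symm
    · exact hg fun h => hij (congrArg _ h)
  simpa only [Set.iUnion_sum, Sum.elim_inl, Sum.elim_inr, Nat.card_sum, Nat.card_fin] using
    hasBallPartition_iUnion disjoint_balls

lemma HasBallPartition.trans (hX : HasBallPartition ρ N X)
    (hρ : ∀ x : α, HasBallPartition ρ' N' (Metric.closedBall x ρ)) :
    HasBallPartition ρ' (N * N') X := by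
  obtain ⟨f, hf, rfl⟩ := hX
  choose g hg hgf using hρ
  have disjoint_balls : Pairwise (Function.onFun Disjoint
      fun p : Fin N × Fin N' => Metric.closedBall (g (f p.1) p.2) ρ') := by
    rintro ⟨i, j⟩ ⟨i', j'⟩ hij
    by_cases h : i = i'
    · subst h
      exact hg (f i) fun h => hij (congrArg _ h)
    · have hsub : ∀ i j, Metric.closedBall (g (f i) j) ρ' ⊆ Metric.closedBall (f i) ρ :=
        fun i j => hgf (f i) ▸ Set.subset_iUnion (fun j => Metric.closedBall (g (f i) j) ρ') j
      exact (hf h).mono (hsub i j) (hsub i' j')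
  have := hasBallPartition_iUnion disjoint_balls
  simp only [Set.iUnion_prod', ← hgf, Nat.card_prod, Nat.card_fin] at this
  exact this

lemma HasBallPartition.mem_iff_of_dist_le [IsUltrametricDist α] (hX : HasBallPartition ρ N X)
    {x y : α} (hxy : dist x y ≤ ρ) : x ∈ X ↔ y ∈ X := by
  obtain ⟨f, -, rfl⟩ := hX
  have mem_of_mem : ∀ {x y : α} {i}, dist x y ≤ ρ → x ∈ Metric.closedBall (f i) ρ →
      y ∈ Metric.closedBall (f i) ρ := fun hxy hx =>
    IsUltrametricDist.closedBall_eq_of_mem hx ▸ Metric.mem_closedBall'.2 hxy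
  simp only [Set.mem_iUnion]
  exact exists_congr fun i => ⟨mem_of_mem hxy, mem_of_mem (dist_comm x y ▸ hxy)⟩

end BallPartition

section Residue

variable {F : Type*} [NormedField F] [IsUltrametricDist F]

lemma residue_eq_residue_iff (x y : (NormedField.valuation (K := F)).valuationSubring) :
    IsLocalRing.residue _ x = IsLocalRing.residue _ y ↔ ‖(x : F) - y‖ < 1 := by
  rw [← sub_eq_zero, ← map_sub, IsLocalRing.residue_eq_zero_iff,
    ValuationSubring.valuation_lt_one_iff,
    ← NormedField.valuation.isEquiv_valuation_valuationSubring.lt_one_iff_lt_one]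
  rfl

lemma finite_residueField [ProperSpace F] :
    Finite (IsLocalRing.ResidueField (NormedField.valuation (K := F)).valuationSubring) := by
  obtain ⟨t, ht, htf, hcov⟩ := (isCompact_closedBall (0 : F) 1).finite_cover_balls one_pos
  have : Finite t := htf
  refine Finite.of_surjective (fun x : t => IsLocalRing.residue _
    (⟨x, mem_closedBall_zero_iff.1 (ht x.2)⟩ : (NormedField.valuation (K := F)).valuationSubring))
    fun y => ?_
  obtain ⟨x, rfl⟩ := IsLocalRing.residue_surjective y
  obtain ⟨z, hz, hxz⟩ := Set.mem_iUnion₂.1 (hcov (mem_closedBall_zero_iff.2 x.2))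
  exact ⟨⟨z, hz⟩, (residue_eq_residue_iff _ _).2 (by rwa [norm_sub_rev, ← dist_eq_norm])⟩

lemma one_lt_residueCard [ProperSpace F] : 1 < residueCard F := by
  have := finite_residueField (F := F)
  rw [residueCard, Finite.one_lt_card_iff_nontrivial]
  infer_instance

variable {ϖ : F}

lemma hasBallPartition_closedBall_norm [ProperSpace F] (hϖ : IsUniformizer ϖ) (b : F) {c : F}
    (hc : c ≠ 0) : HasBallPartition (‖c‖ * ‖ϖ‖) (residueCard F) (Metric.closedBall b ‖c‖) := by
  have := finite_residueField (F := F)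
  obtain ⟨f, hf⟩ := (IsLocalRing.residue_surjective
    (R := (NormedField.valuation (K := F)).valuationSubring)).hasRightInverse
  have hc' : 0 < ‖c‖ := norm_pos_iff.2 hc
  have disjoint_balls : Pairwise (Function.onFun Disjoint
      fun t => Metric.closedBall (b + c * f t) (‖c‖ * ‖ϖ‖)) := by
    intro t t' htt'
    refine (IsUltrametricDist.closedBall_eq_or_disjoint _ _ _).resolve_left fun h => htt' ?_
    have hle : ‖c‖ * ‖(f t : F) - f t'‖ ≤ ‖c‖ * ‖ϖ‖ := by
      have : b + c * f t ∈ Metric.closedBall (b + c * f t') (‖c‖ * ‖ϖ‖) :=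
        h ▸ Metric.mem_closedBall_self (by positivity)
      rwa [mem_closedBall_iff_norm, add_sub_add_left_eq_sub, ← mul_sub, norm_mul] at this
    rw [← hf t, ← hf t', residue_eq_residue_iff]
    exact (le_of_mul_le_mul_left hle hc').trans_lt hϖ.2.1
  suffices h : Metric.closedBall b ‖c‖ = ⋃ t, Metric.closedBall (b + c * f t) (‖c‖ * ‖ϖ‖) from
    h ▸ hasBallPartition_iUnion disjoint_balls
  refine Set.Subset.antisymm (fun x hx => ?_) (Set.iUnion_subset fun t => ?_)
  · have hy : ‖(x - b) / c‖ ≤ 1 := by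
      rwa [norm_div, div_le_one hc', ← mem_closedBall_iff_norm]
    obtain ⟨t, hres⟩ : ∃ t, ‖(x - b) / c - f t‖ ≤ ‖ϖ‖ :=
      ⟨_, hϖ.2.2 _ ((residue_eq_residue_iff ⟨(x - b) / c, hy⟩ _).1 (hf _).symm)⟩
    refine Set.mem_iUnion.2 ⟨t, mem_closedBall_iff_norm.2 ?_⟩
    calc ‖x - (b + c * f t)‖ = ‖c * ((x - b) / c - f t)‖ := by
          rw [mul_sub, mul_div_cancel₀ _ hc, sub_sub]
      _ ≤ ‖c‖ * ‖ϖ‖ := by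
          rw [norm_mul]
          exact mul_le_mul_of_nonneg_left hres hc'.le
  · have mem_ball : b + c * f t ∈ Metric.closedBall b ‖c‖ := by
      rw [mem_closedBall_iff_norm, add_sub_cancel_left, norm_mul]
      exact mul_le_of_le_one_right hc'.le (f t).2
    rw [IsUltrametricDist.closedBall_eq_of_mem mem_ball]
    exact Metric.closedBall_subset_closedBall (mul_le_of_le_one_right hc'.le hϖ.2.1.le)

lemma hasBallPartition_closedBall_zpow [ProperSpace F] (hϖ : IsUniformizer ϖ) (x : F) (n : ℤ)
    (j : ℕ) : HasBallPartition (‖ϖ‖ ^ n) (residueCard F ^ j)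
      (Metric.closedBall x (‖ϖ‖ ^ (n - j))) := by
  induction j generalizing x with
  | zero => simpa using hasBallPartition_closedBall_self x
  | succ j ih =>
    have refined := hasBallPartition_closedBall_norm hϖ x (zpow_ne_zero (n - (j + 1 : ℕ)) hϖ.1)
    rw [norm_zpow, ← zpow_add_one₀ hϖ.norm_pos.ne',
      show n - (j + 1 : ℕ) + 1 = n - j by push_cast; ring] at refined
    rw [pow_succ']
    exact refined.trans ih

end Residue

section Iwasawa

variable {F : Type*} [NormedField F]

/-- The invertible matrix `!![α, x; 0, β]`. -/
def upper (α β : Fˣ) (x : F) : Matrix.GeneralLinearGroup (Fin 2) F where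
  val := !![(α : F), x; 0, (β : F)]
  inv := !![(α : F)⁻¹, -((α : F)⁻¹ * x * (β : F)⁻¹); 0, (β : F)⁻¹]
  val_inv := by simp [Matrix.one_fin_two, ← mul_assoc]
  inv_val := by simp [Matrix.one_fin_two]

lemma coe_upper (α β : Fˣ) (x : F) :
    (upper α β x : Matrix (Fin 2) (Fin 2) F) = !![(α : F), x; 0, (β : F)] := rfl

lemma coe_upper_inv (α β : Fˣ) (x : F) :
    ((upper α β x)⁻¹ : Matrix.GeneralLinearGroup (Fin 2) F).val =
      !![(α : F)⁻¹, -((α : F)⁻¹ * x * (β : F)⁻¹); 0, (β : F)⁻¹] := rfl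

lemma upper_mul (α β α' β' : Fˣ) (x x' : F) :
    upper α β x * upper α' β' x' = upper (α * α') (β * β') (α * x' + x * β') :=
  Units.ext (by simp [coe_upper])

lemma upper_inv (α β : Fˣ) (x : F) :
    (upper α β x)⁻¹ = upper α⁻¹ β⁻¹ (-((α : F)⁻¹ * x * (β : F)⁻¹)) :=
  Units.ext (by simp only [coe_upper_inv, coe_upper, Units.val_inv_eq_inv_val])

/-- The permutation matrix `!![0, 1; 1, 0]`. -/
def swap (F : Type*) [NormedField F] : Matrix.GeneralLinearGroup (Fin 2) F where
  val := !![0, 1; 1, 0]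
  inv := !![0, 1; 1, 0]
  val_inv := by simp [Matrix.one_fin_two]
  inv_val := by simp [Matrix.one_fin_two]

variable [IsUltrametricDist F]

lemma norm_mul_apply_le_one {n : ℕ} {A B : Matrix (Fin n) (Fin n) F} (hA : ∀ i j, ‖A i j‖ ≤ 1)
    (hB : ∀ i j, ‖B i j‖ ≤ 1) (i j : Fin n) : ‖(A * B) i j‖ ≤ 1 := by
  rw [Matrix.mul_apply]
  refine IsUltrametricDist.norm_sum_le_of_forall_le_of_nonneg zero_le_one fun k _ => ?_
  rw [norm_mul]
  exact mul_le_one₀ (hA i k) (norm_nonneg _) (hB k j)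

variable (F) in
/-- The set `integralGL n F`, that is `GL_n(𝓞_F)`, as a subgroup of `GL_n(F)`. -/
def integralSubgroup (n : ℕ) : Subgroup (Matrix.GeneralLinearGroup (Fin n) F) where
  carrier := integralGL n F
  mul_mem' {g h} hg hh i j := by
    rw [mul_inv_rev, Units.val_mul, Units.val_mul]
    exact ⟨norm_mul_apply_le_one (fun i j => (hg i j).1) (fun i j => (hh i j).1) i j,
      norm_mul_apply_le_one (fun i j => (hh i j).2) (fun i j => (hg i j).2) i j⟩
  one_mem' i j := by
    rw [inv_one, Units.val_one, Matrix.one_apply]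
    split_ifs <;> simp
  inv_mem' {g} hg i j := by
    rw [inv_inv]
    exact (hg i j).symm

lemma mem_integralSubgroup {n : ℕ} {g : Matrix.GeneralLinearGroup (Fin n) F} :
    g ∈ integralSubgroup F n ↔ g ∈ integralGL n F := Iff.rfl

lemma upper_mem_integralSubgroup {α β : Fˣ} {x : F} :
    upper α β x ∈ integralSubgroup F 2 ↔ ‖(α : F)‖ = 1 ∧ ‖(β : F)‖ = 1 ∧ ‖x‖ ≤ 1 := by
  have norm_eq_one : ∀ γ : Fˣ, ‖(γ : F)‖ ≤ 1 ∧ ‖(γ : F)⁻¹‖ ≤ 1 → ‖(γ : F)‖ = 1 := fun γ hγ =>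
    hγ.1.antisymm ((inv_le_one₀ (norm_pos_iff.2 γ.ne_zero)).1 (norm_inv (γ : F) ▸ hγ.2))
  refine ⟨fun h => ⟨norm_eq_one α (h 0 0), norm_eq_one β (h 1 1), (h 0 1).1⟩, ?_⟩
  rintro ⟨hα, hβ, hx⟩ i j
  rw [coe_upper_inv, coe_upper]
  fin_cases i <;> fin_cases j <;> simp [hα, hβ, hx]

lemma swap_mem_integralSubgroup : swap F ∈ integralSubgroup F 2 := by
  intro i j
  fin_cases i <;> fin_cases j <;> simp [swap]

lemma exists_mul_apply_one_zero_eq_zero (h : Matrix.GeneralLinearGroup (Fin 2) F) :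
    ∃ k ∈ integralSubgroup F 2, (k * h).val 1 0 = 0 := by
  wlog hle : ‖h.val 1 0‖ ≤ ‖h.val 0 0‖ generalizing h
  · obtain ⟨k, hk, h0⟩ := this (swap F * h)
      (by simpa [swap, Matrix.mul_apply, Fin.sum_univ_two] using (not_le.1 hle).le)
    exact ⟨k * swap F, mul_mem hk swap_mem_integralSubgroup, mul_assoc k _ h ▸ h0⟩
  have h00 : h.val 0 0 ≠ 0 := fun h00 => by
    have h10 : h.val 1 0 = 0 := by rwa [h00, norm_zero, norm_le_zero_iff] at hle
    exact (Matrix.GeneralLinearGroup.det h).ne_zero (by simp [Matrix.det_fin_two, h00, h10])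
  refine ⟨swap F * upper 1 1 (-(h.val 1 0 / h.val 0 0)) * swap F, mul_mem (mul_mem
    swap_mem_integralSubgroup (upper_mem_integralSubgroup.2 ?_)) swap_mem_integralSubgroup, ?_⟩
  · simpa using div_le_one_of_le₀ hle (norm_nonneg _)
  · simp [swap, coe_upper, Matrix.mul_apply, Fin.sum_univ_two, h00]

variable {ϖ : F}

/-- A uniformizer as a unit of the field. -/
def IsUniformizer.unit (h : IsUniformizer ϖ) : Fˣ := Units.mk0 ϖ h.1

omit [IsUltrametricDist F] in
lemma IsUniformizer.coe_unit_zpow (h : IsUniformizer ϖ) (k : ℤ) :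
    ((h.unit ^ k : Fˣ) : F) = ϖ ^ k :=
  Units.val_zpow_eq_zpow_val _ _

lemma IsUniformizer.exists_eq_mul_upper_of_apply_eq_zero (hϖ : IsUniformizer ϖ)
    {g : Matrix.GeneralLinearGroup (Fin 2) F} (hg : g.val 1 0 = 0) :
    ∃ k ∈ integralSubgroup F 2, ∃ (m n : ℤ) (x : F),
      g = k * upper (hϖ.unit ^ m) (hϖ.unit ^ n) x := by
  have hdet : g.val 0 0 * g.val 1 1 ≠ 0 := by
    simpa [Matrix.det_fin_two, hg] using (Matrix.GeneralLinearGroup.det g).ne_zero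
  obtain ⟨h0, h1⟩ := mul_ne_zero_iff.1 hdet
  obtain ⟨m, hm⟩ := hϖ.exists_norm_eq_zpow h0
  obtain ⟨n, hn⟩ := hϖ.exists_norm_eq_zpow h1
  refine ⟨upper (Units.mk0 _ h0 * hϖ.unit ^ (-m)) (Units.mk0 _ h1 * hϖ.unit ^ (-n)) 0,
    upper_mem_integralSubgroup.2 ?_, m, n, g.val 0 1 * (g.val 0 0)⁻¹ * ϖ ^ m, ?_⟩
  · simp [hm, hn, hϖ.coe_unit_zpow, -zpow_neg, hϖ.zpow_mul_zpow]
  · rw [upper_mul]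
    have hϖm : ϖ ^ m ≠ 0 := zpow_ne_zero _ hϖ.1
    ext i j
    fin_cases i <;> fin_cases j <;> simp [coe_upper, hg, hϖ.coe_unit_zpow]
    field_simp

theorem IsUniformizer.exists_eq_mul_upper (hϖ : IsUniformizer ϖ)
    (h : Matrix.GeneralLinearGroup (Fin 2) F) :
    ∃ k ∈ integralSubgroup F 2, ∃ (m n : ℤ) (x : F),
      h = k * upper (hϖ.unit ^ m) (hϖ.unit ^ n) x := by
  obtain ⟨k, hk, h0⟩ := exists_mul_apply_one_zero_eq_zero h
  obtain ⟨k', hk', m, n, x, hkh⟩ := hϖ.exists_eq_mul_upper_of_apply_eq_zero h0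
  exact ⟨k⁻¹ * k', mul_mem (inv_mem hk) hk', m, n, x, by rw [mul_assoc, ← hkh, inv_mul_cancel_left]⟩

lemma norm_det_le_one_of_mem_integralSubgroup {k : Matrix.GeneralLinearGroup (Fin 2) F}
    (hk : k ∈ integralSubgroup F 2) : ‖k.val.det‖ ≤ 1 := by
  rw [Matrix.det_fin_two]
  refine norm_sub_le_of_norm_le ?_ ?_ <;> rw [norm_mul] <;>
  exact mul_le_one₀ (hk _ _).1 (norm_nonneg _) (hk _ _).1

lemma norm_det_of_mem_integralSubgroup {k : Matrix.GeneralLinearGroup (Fin 2) F}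
    (hk : k ∈ integralSubgroup F 2) : ‖k.val.det‖ = 1 := by
  have det_mul_det_inv : ‖k.val.det‖ * ‖(k⁻¹).val.det‖ = 1 := by
    rw [← norm_mul, ← Matrix.det_mul, ← Units.val_mul, mul_inv_cancel, Units.val_one,
      Matrix.det_one, norm_one]
  refine (norm_det_le_one_of_mem_integralSubgroup hk).antisymm (det_mul_det_inv ▸ ?_)
  exact mul_le_of_le_one_right (norm_nonneg _)
    (norm_det_le_one_of_mem_integralSubgroup (inv_mem hk))

lemma IsUniformizer.ord_det_mul_upper (hϖ : IsUniformizer ϖ)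
    {k : Matrix.GeneralLinearGroup (Fin 2) F} (hk : k ∈ integralSubgroup F 2) (m n : ℤ) (x : F) :
    ord ϖ (k * upper (hϖ.unit ^ m) (hϖ.unit ^ n) x).val.det = m + n := by
  apply hϖ.ord_eq_of_norm_eq
  rw [Units.val_mul, Matrix.det_mul, norm_mul, norm_det_of_mem_integralSubgroup hk, one_mul,
    coe_upper, Matrix.det_fin_two_of, mul_zero, sub_zero, hϖ.coe_unit_zpow, hϖ.coe_unit_zpow,
    norm_mul, norm_zpow, norm_zpow, hϖ.zpow_mul_zpow]

end Iwasawa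

section Unimodular

open Measure

lemma modularCharacter_conj {G : Type*} [TopologicalSpace G] [Group G] [IsTopologicalGroup G]
    [LocallyCompactSpace G] (g h : G) :
    modularCharacter (g * h * g⁻¹) = modularCharacter h := by
  rw [map_mul, map_mul, mul_right_comm, ← map_mul, mul_inv_cancel, map_one, one_mul]

lemma modularCharacter_of_central {G : Type*} [TopologicalSpace G] [Group G] [IsTopologicalGroup G]
    [LocallyCompactSpace G] {z : G} (hz : ∀ g, g * z = z * g) : modularCharacter z = 1 := by
  borelize G
  change modularCharacterFun z = 1
  rw [modularCharacterFun_eq_haarScalarFactor haar]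
  have map_haar : map (fun g => g * z) (haar : Measure G) = haar := by
    rw [funext hz, map_mul_left_eq_self]
  simp only [map_haar, haarScalarFactor_self]

variable {F : Type*} [NormedField F] [LocallyCompactSpace F]

instance : LocallyCompactSpace (Matrix (Fin 2) (Fin 2) F) :=
  inferInstanceAs (LocallyCompactSpace (Fin 2 → Fin 2 → F))

lemma modularCharacter_unipotent [Nontrivial Fˣ] (x : F) :
    modularCharacter (upper (1 : Fˣ) 1 x) = 1 := by
  obtain ⟨t, ht⟩ := exists_ne (1 : Fˣ)
  have ht' : (t : F) - 1 ≠ 0 := sub_ne_zero.2 (Units.val_eq_one.not.2 ht)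
  set y := x / (t - 1)
  have conj_unipotent :
      upper t 1 0 * upper 1 1 y * (upper t 1 0)⁻¹ = upper 1 1 x * upper 1 1 y := by
    rw [mul_inv_eq_iff_eq_mul, upper_mul, upper_mul, upper_mul]
    congr 1 <;> simp [y]
    field_simp
    ring
  have hmul : modularCharacter (upper (1 : Fˣ) 1 y) =
      modularCharacter (upper (1 : Fˣ) 1 x) * modularCharacter (upper (1 : Fˣ) 1 y) := by
    rw [← map_mul, ← conj_unipotent, modularCharacter_conj]
  exact (mul_eq_right₀ (modularCharacterFun_pos _).ne').1 hmul.symm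

lemma modularCharacter_diagonal (α β : Fˣ) : modularCharacter (upper α β (0 : F)) = 1 := by
  have conj_swap : swap F * upper α β 0 * (swap F)⁻¹ = upper β α 0 := by
    rw [mul_inv_eq_iff_eq_mul]
    exact Units.ext (by simp [swap, coe_upper])
  have scalar_central : ∀ g, g * (upper α β (0 : F) * upper β α 0) =
      upper α β 0 * upper β α 0 * g := fun g => by
    rw [upper_mul]
    ext i j
    fin_cases i <;> fin_cases j <;> simp [coe_upper, Matrix.mul_apply, Fin.sum_univ_two] <;> ring
  have sq_eq_one := modularCharacter_of_central scalar_central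
  rw [map_mul, ← conj_swap, modularCharacter_conj, ← pow_two] at sq_eq_one
  exact (pow_eq_one_iff_of_nonneg zero_le two_ne_zero).1 sq_eq_one

lemma modularCharacter_upper [Nontrivial Fˣ] (α β : Fˣ) (x : F) :
    modularCharacter (upper α β x) = 1 := by
  have factorization : upper α β x = upper 1 1 (x * (β : F)⁻¹) * upper α β 0 := by
    rw [upper_mul]
    congr 1 <;> simp
  rw [factorization, map_mul, modularCharacter_unipotent, modularCharacter_diagonal, one_mul]

lemma measure_preimage_mul_upper [Nontrivial Fˣ]
    [MeasurableSpace (Matrix.GeneralLinearGroup (Fin 2) F)]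
    [BorelSpace (Matrix.GeneralLinearGroup (Fin 2) F)]
    (μ : Measure (Matrix.GeneralLinearGroup (Fin 2) F)) [μ.IsHaarMeasure]
    (α β : Fˣ) (x : F) {A : Set (Matrix.GeneralLinearGroup (Fin 2) F)} (hA : IsOpen A) :
    μ ((fun g => g * upper α β x) ⁻¹' A) = μ A := by
  have factor_eq_one : modularCharacterFun (upper α β x) = 1 := modularCharacter_upper α β x
  rw [modularCharacterFun_eq_haarScalarFactor μ] at factor_eq_one
  have map_eq_smul := measure_isHaarMeasure_eq_smul_of_isOpen (map (· * upper α β x) μ) μ hA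
  rwa [factor_eq_one, one_smul, map_apply (measurable_mul_const _) hA.measurableSet]
    at map_eq_smul

end Unimodular

section Cell

variable {F : Type*} [NormedField F] [IsUltrametricDist F]

/-- The union of the cosets `GL_2(𝓞_F) * upper α β x` over `x ∈ X`. -/
def cell (α β : Fˣ) (X : Set F) : Set (Matrix.GeneralLinearGroup (Fin 2) F) :=
  {h | ∃ x ∈ X, h * (upper α β x)⁻¹ ∈ integralSubgroup F 2}

lemma cell_iUnion {ι : Type*} (α β : Fˣ) (X : ι → Set F) :
    cell α β (⋃ i, X i) = ⋃ i, cell α β (X i) := by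
  ext h
  simp only [cell, Set.mem_iUnion, Set.mem_ofPred_eq]
  exact ⟨fun ⟨x, ⟨i, hx⟩, h⟩ => ⟨i, x, hx, h⟩, fun ⟨i, x, hx, h⟩ => ⟨x, ⟨i, hx⟩, h⟩⟩

lemma upper_mul_inv_mem_integralSubgroup_iff {α β α' β' : Fˣ} {x x' : F} :
    upper α β x * (upper α' β' x')⁻¹ ∈ integralSubgroup F 2 ↔
      ‖(α : F)‖ = ‖(α' : F)‖ ∧ ‖(β : F)‖ = ‖(β' : F)‖ ∧ ‖x - α / α' * x'‖ ≤ ‖(β' : F)‖ := by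
  have entry : (α : F) * -((α' : F)⁻¹ * x' * (β' : F)⁻¹) + x * (β' : F)⁻¹ =
      (x - α / α' * x') / β' := by
    field_simp
    ring
  have norm_pos : ∀ γ : Fˣ, 0 < ‖(γ : F)‖ := fun γ => norm_pos_iff.2 γ.ne_zero
  rw [upper_inv, upper_mul, upper_mem_integralSubgroup, Units.val_inv_eq_inv_val, entry]
  simp only [Units.val_mul, Units.val_inv_eq_inv_val, norm_mul, norm_inv, norm_div,
    mul_inv_eq_one₀ (norm_pos _).ne', div_le_one (norm_pos _)]

lemma cell_closedBall (α β : Fˣ) (x : F) :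
    cell α β (Metric.closedBall x ‖(β : F)‖) =
      (fun h => h * upper α⁻¹ β⁻¹ (-((α : F)⁻¹ * x * (β : F)⁻¹))) ⁻¹' integralGL 2 F := by
  ext h
  rw [Set.mem_preimage, ← upper_inv, ← mem_integralSubgroup]
  refine ⟨fun ⟨y, hy, h⟩ => ?_, fun h => ⟨x, Metric.mem_closedBall_self (norm_nonneg _), h⟩⟩
  have mem : upper α β y * (upper α β x)⁻¹ ∈ integralSubgroup F 2 := by
    rw [upper_mul_inv_mem_integralSubgroup_iff, div_self α.ne_zero, one_mul]
    exact ⟨rfl, rfl, mem_closedBall_iff_norm.1 hy⟩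
  simpa only [mul_assoc, inv_mul_cancel_left] using mul_mem h mem

lemma disjoint_cell {α β : Fˣ} {X Y : Set F} (hXY : Disjoint X Y)
    (hX : ∀ x y, ‖x - y‖ ≤ ‖(β : F)‖ → x ∈ X → y ∈ X) : Disjoint (cell α β X) (cell α β Y) := by
  refine Set.disjoint_left.2 fun h ⟨x, hx, hhx⟩ ⟨y, hy, hhy⟩ => Set.disjoint_left.1 hXY ?_ hy
  have mem : upper α β x * (upper α β y)⁻¹ ∈ integralSubgroup F 2 := by
    simpa [mul_assoc] using mul_mem (inv_mem hhx) hhy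
  rw [upper_mul_inv_mem_integralSubgroup_iff, div_self α.ne_zero, one_mul] at mem
  exact hX x y mem.2.2 hx

lemma isOpen_integralGL (n : ℕ) : IsOpen (integralGL n F) := by
  have eq_iInter : integralGL n F = ⋂ i : Fin n, ⋂ j : Fin n,
      ((fun g : Matrix.GeneralLinearGroup (Fin n) F => g.val i j) ⁻¹' Metric.closedBall 0 1 ∩
      (fun g : Matrix.GeneralLinearGroup (Fin n) F => (g⁻¹).val i j) ⁻¹'
        Metric.closedBall 0 1) := by
    ext g
    simp [integralGL]
  rw [eq_iInter]
  refine isOpen_iInter_of_finite fun i => isOpen_iInter_of_finite fun j => ?_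
  have isOpen_ball : IsOpen (Metric.closedBall (0 : F) 1) :=
    IsUltrametricDist.isOpen_closedBall _ one_ne_zero
  exact (isOpen_ball.preimage (Units.continuous_val.matrix_elem i j)).inter
    (isOpen_ball.preimage ((Units.continuous_val.comp continuous_inv).matrix_elem i j))

lemma isOpen_cell (α β : Fˣ) (X : Set F) : IsOpen (cell α β X) := by
  have eq_iUnion :
      cell α β X = ⋃ x ∈ X, (fun h => h * (upper α β x)⁻¹) ⁻¹' integralGL 2 F := by
    ext h
    simp [cell, mem_integralSubgroup]
  rw [eq_iUnion]
  exact isOpen_biUnion fun x _ => (isOpen_integralGL 2).preimage (continuous_mul_const _)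

theorem measure_cell [LocallyCompactSpace F] [Nontrivial Fˣ]
    [MeasurableSpace (Matrix.GeneralLinearGroup (Fin 2) F)]
    [BorelSpace (Matrix.GeneralLinearGroup (Fin 2) F)]
    (μ : Measure (Matrix.GeneralLinearGroup (Fin 2) F)) [μ.IsHaarMeasure] (α : Fˣ) {β : Fˣ}
    {N : ℕ} {X : Set F} (hX : HasBallPartition ‖(β : F)‖ N X) :
    μ (cell α β X) = N * μ (integralGL 2 F) := by
  obtain ⟨f, hf, rfl⟩ := hX
  rw [cell_iUnion, measure_iUnion]
  · simp only [cell_closedBall, measure_preimage_mul_upper μ _ _ _ (isOpen_integralGL 2),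
      tsum_fintype, Finset.sum_const, Finset.card_univ, Fintype.card_fin, nsmul_eq_mul]
  · exact fun i j hij => disjoint_cell (hf hij) fun x y hxy =>
      ((hasBallPartition_closedBall_self _).mem_iff_of_dist_le (dist_eq_norm x y ▸ hxy)).1
  · exact fun i => (isOpen_cell α β _).measurableSet

lemma IsUniformizer.mul_upper_mem_cell_iff {ϖ : F} (hϖ : IsUniformizer ϖ) {m n m' n' : ℤ} {x : F}
    {N : ℕ} {X : Set F} (hX : HasBallPartition (‖ϖ‖ ^ n') N X)
    {k : Matrix.GeneralLinearGroup (Fin 2) F} (hk : k ∈ integralSubgroup F 2) :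
    k * upper (hϖ.unit ^ m) (hϖ.unit ^ n) x ∈ cell (hϖ.unit ^ m') (hϖ.unit ^ n') X ↔
      m = m' ∧ n = n' ∧ x ∈ X := by
  simp only [cell, Set.mem_ofPred_eq, mul_assoc, (integralSubgroup F 2).mul_mem_cancel_left hk,
    upper_mul_inv_mem_integralSubgroup_iff, hϖ.coe_unit_zpow, norm_zpow, hϖ.zpow_inj]
  constructor
  · rintro ⟨y, hy, rfl, rfl, hxy⟩
    rw [div_self (zpow_ne_zero _ hϖ.1), one_mul, ← dist_eq_norm] at hxy
    exact ⟨rfl, rfl, (hX.mem_iff_of_dist_le hxy).2 hy⟩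
  · rintro ⟨rfl, rfl, hx⟩
    refine ⟨x, hx, rfl, rfl, ?_⟩
    rw [div_self (zpow_ne_zero _ hϖ.1), one_mul, sub_self, norm_zero]
    exact zpow_nonneg (norm_nonneg ϖ) _

end Cell

section QuadraticForm

variable {F : Type*} [NormedField F] [IsUltrametricDist F]

lemma exists_norm_eq_one_mul_sq_eq_add_one [CompleteSpace F] {c : F} (hc : ‖c‖ < 1) :
    ∃ w : F, ‖w‖ = 1 ∧ c * w ^ 2 = w + 1 := by
  let f : F → F := fun w => c * w ^ 2 - 1
  have norm_f : ∀ w ∈ Metric.closedBall (0 : F) 1, ‖f w‖ = 1 := fun w hw => by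
    have hlt : ‖c * w ^ 2‖ < ‖(1 : F)‖ := by
      rw [norm_mul, norm_pow, norm_one]
      exact mul_lt_one_of_nonneg_of_lt_one_left (norm_nonneg c) hc
        (pow_le_one₀ (norm_nonneg w) (mem_closedBall_zero_iff.1 hw))
    rw [norm_sub_eq_of_lt hlt, norm_one]
  have mapsTo_f : Set.MapsTo f (Metric.closedBall 0 1) (Metric.closedBall 0 1) := fun w hw =>
    mem_closedBall_zero_iff.2 (norm_f w hw).le
  have contracting : ContractingWith ‖c‖₊ (mapsTo_f.restrict f _ _) := by
    refine ⟨hc, LipschitzWith.of_dist_le_mul fun x y => ?_⟩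
    rw [Subtype.dist_eq, Subtype.dist_eq, dist_eq_norm, dist_eq_norm, coe_nnnorm]
    have hadd : ‖(x : F) + y‖ ≤ 1 :=
      norm_add_le_of_norm_le (mem_closedBall_zero_iff.1 x.2) (mem_closedBall_zero_iff.1 y.2)
    calc ‖f x - f y‖ = ‖c‖ * (‖(x : F) + y‖ * ‖(x : F) - y‖) := by
          rw [← norm_mul, ← norm_mul]; congr 1; simp only [f]; ring
      _ ≤ ‖c‖ * ‖(x : F) - y‖ := by
          gcongr; exact mul_le_of_le_one_left (norm_nonneg _) hadd
  obtain ⟨w, hw, hfix, -⟩ := contracting.exists_fixedPoint' Metric.isClosed_closedBall.isComplete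
    mapsTo_f (Metric.mem_closedBall_self zero_le_one) (edist_ne_top _ _)
  exact ⟨w, hfix ▸ norm_f w hw, sub_eq_iff_eq_add.1 hfix⟩

lemma exists_quadratic_eq_mul [CompleteSpace F] {κ τ : F} (hκ : κ ≠ 0) (h : ‖κ‖ < ‖τ‖ ^ 2)
    (α : F) : ∃ x₁ x₂ : F, ‖x₁‖ = ‖α‖ / ‖τ‖ ∧ ‖x₂‖ = ‖α‖ * (‖τ‖ / ‖κ‖) ∧
      ‖x₁ - x₂‖ = ‖α‖ * (‖τ‖ / ‖κ‖) ∧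
      ∀ x, α ^ 2 + τ * α * x - κ * x ^ 2 = -κ * ((x - x₁) * (x - x₂)) := by
  have hκ' : 0 < ‖κ‖ := norm_pos_iff.2 hκ
  have hτ : τ ≠ 0 := fun h0 => by
    rw [h0, norm_zero, zero_pow two_ne_zero] at h
    exact h.not_ge (norm_nonneg κ)
  have hτ' : 0 < ‖τ‖ := norm_pos_iff.2 hτ
  obtain ⟨w, hw, hroot⟩ := exists_norm_eq_one_mul_sq_eq_add_one (c := κ / τ ^ 2)
    (by rwa [norm_div, norm_pow, div_lt_one (pow_pos hτ' 2)])
  have norm_root : ‖w / τ‖ = ‖τ‖⁻¹ := by rw [norm_div, hw, one_div]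
  have root_lt : ‖w / τ‖ < ‖τ / κ‖ := by
    rwa [norm_root, norm_div, lt_div_iff₀ hκ', inv_mul_lt_iff₀ hτ', ← pow_two]
  have norm_other : ‖τ / κ - w / τ‖ = ‖τ‖ / ‖κ‖ := by
    rw [norm_sub_rev, norm_sub_eq_of_lt root_lt, norm_div]
  refine ⟨α * (w / τ), α * (τ / κ - w / τ), ?_, ?_, ?_, fun x => ?_⟩
  · rw [norm_mul, norm_root, div_eq_mul_inv]
  · rw [norm_mul, norm_other]
  · rw [← mul_sub, norm_mul, norm_sub_eq_of_lt (by rwa [norm_other, ← norm_div]), norm_other]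
  · field_simp at hroot ⊢
    linear_combination -α ^ 2 * hroot

lemma norm_sub_mul_norm_sub_le_iff {x₁ x₂ : F} {ρ : ℝ} (hρ : 0 ≤ ρ) (h : ρ < ‖x₁ - x₂‖) (x : F) :
    ‖x - x₁‖ * ‖x - x₂‖ ≤ ρ * ‖x₁ - x₂‖ ↔ ‖x - x₁‖ ≤ ρ ∨ ‖x - x₂‖ ≤ ρ := by
  have hmax : ‖x₁ - x₂‖ ≤ max ‖x - x₁‖ ‖x - x₂‖ := by
    rw [← sub_sub_sub_cancel_left x₂ x₁ x, ← norm_neg, neg_sub]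
    exact norm_sub_le_of_norm_le (le_max_left _ _) (le_max_right _ _)
  have hpos : 0 < ‖x₁ - x₂‖ := hρ.trans_lt h
  constructor
  · contrapose!
    rintro ⟨h₁, h₂⟩
    rcases le_max_iff.1 hmax with hle | hle
    · rw [mul_comm ‖x - x₁‖]
      exact mul_lt_mul h₂ hle hpos (norm_nonneg _)
    · exact mul_lt_mul h₁ hle hpos (norm_nonneg _)
  · rintro (hle | hle)
    · have : ‖x - x₂‖ = ‖x₁ - x₂‖ := by
        rw [← sub_add_sub_cancel x x₁ x₂, norm_add_eq_of_lt (hle.trans_lt h)]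
      rw [this]
      gcongr
    · have : ‖x - x₁‖ = ‖x₁ - x₂‖ := by
        rw [← sub_sub_sub_cancel_right x x₁ x₂, norm_sub_eq_of_lt (hle.trans_lt h)]
      rw [this, mul_comm]
      gcongr

lemma norm_sq_le_norm_quadratic {κ τ α x : F} (hτ : ‖τ‖ ^ 2 < ‖κ‖)
    (hne : ‖α‖ ^ 2 ≠ ‖κ‖ * ‖x‖ ^ 2) :
    ‖α‖ ^ 2 ≤ ‖α ^ 2 + τ * α * x - κ * x ^ 2‖ := by
  have mid_sq_le : ‖τ * α * x‖ ^ 2 ≤ ‖α‖ ^ 2 * (‖κ‖ * ‖x‖ ^ 2) := by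
    rw [norm_mul, norm_mul]
    nlinarith [mul_le_mul_of_nonneg_right hτ.le (by positivity : 0 ≤ ‖α‖ ^ 2 * ‖x‖ ^ 2)]
  rcases hne.lt_or_gt with hlt | hlt
  · have mid_lt : ‖τ * α * x‖ < ‖κ * x ^ 2‖ := by
      rw [norm_mul κ, norm_pow]
      refine lt_of_pow_lt_pow_left₀ 2 (by positivity) (mid_sq_le.trans_lt ?_)
      rw [pow_two (‖κ‖ * ‖x‖ ^ 2)]
      exact mul_lt_mul_of_pos_right hlt (hlt.trans_le' (by positivity))
    have hsum : ‖α ^ 2 + τ * α * x‖ < ‖κ * x ^ 2‖ :=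
      (IsUltrametricDist.norm_add_le_max _ _).trans_lt
        (max_lt (by rwa [norm_pow, norm_mul κ, norm_pow]) mid_lt)
    rw [norm_sub_eq_of_lt hsum, norm_mul, norm_pow]
    exact hlt.le
  · have mid_lt : ‖τ * α * x‖ < ‖α ^ 2‖ := by
      rw [norm_pow]
      refine lt_of_pow_lt_pow_left₀ 2 (by positivity) (mid_sq_le.trans_lt ?_)
      rw [pow_two (‖α‖ ^ 2)]
      exact mul_lt_mul_of_pos_left hlt (hlt.trans_le' (by positivity))
    have hdiff : ‖κ * x ^ 2 - τ * α * x‖ < ‖α ^ 2‖ := by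
      rw [sub_eq_add_neg]
      refine (IsUltrametricDist.norm_add_le_max _ _).trans_lt (max_lt ?_ (by rwa [norm_neg]))
      rwa [norm_mul, norm_pow, norm_pow]
    rw [← sub_sub_eq_add_sub, norm_sub_rev, norm_sub_eq_of_lt hdiff, norm_pow]

end QuadraticForm

section Admissible

variable {F : Type*} [NormedField F] {ϖ κ τ : F} {r M R n i : ℕ} {B C : ℤ}

/-- The set of all `x` for which the coset of the matrix `!![ϖ ^ m, x; 0, ϖ ^ n]` contributes to
the orbital integral of `!![a, b; c, d]`, where `c = κ b`, `d - a = τ b` and `B`, `C` are the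
valuations of `b` and `c`. -/
def admissible (ϖ κ τ : F) (r : ℕ) (B C m n : ℤ) : Set F :=
  {x | ‖x‖ ≤ 1 ∧ ‖x‖ ≤ ‖ϖ‖ ^ (m - C - r) ∧
    ‖(ϖ ^ m) ^ 2 + τ * ϖ ^ m * x - κ * x ^ 2‖ ≤ ‖ϖ‖ ^ (m + n - r - B)}

/-- The number of classes of `x` modulo `ϖ ^ n` in `admissible ϖ κ τ r B C (r + C + n - i) n`, where
`2 M + 1 = 2 r + B + C` and `R = r + B + v(τ)`, capped at `R = M + 1`. -/
def classCount (q M R n i : ℕ) : ℕ :=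
  q ^ min n (min (i / 2) R) *
    if R ≤ M then
      (if i ≤ 2 * M + 1 + (n - R) then 1 else 0) + (if 2 * R < i ∧ i ≤ R + n then 1 else 0)
    else if i ≤ 2 * M + 1 then 1 else 0

lemma classCount_eq_zero {q : ℕ} (hR : R ≤ M + 1) (hi : 2 * (M + 1) + n ≤ i) :
    classCount q M R n i = 0 := by
  rw [classCount, mul_eq_zero]
  right
  split_ifs <;> omega

lemma norm_sq_zpow (m : ℤ) : ‖(ϖ ^ m) ^ 2‖ = ‖ϖ‖ ^ (2 * m) := by
  rw [norm_pow, norm_zpow, ← zpow_natCast, ← zpow_mul, mul_comm, Nat.cast_ofNat]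

lemma norm_mul_zpow_mul_le (hϖ : IsUniformizer ϖ) {t m k : ℤ} (hτ : ‖τ‖ ≤ ‖ϖ‖ ^ t) {x : F}
    (hx : ‖x‖ ≤ ‖ϖ‖ ^ k) : ‖τ * ϖ ^ m * x‖ ≤ ‖ϖ‖ ^ (t + m + k) := by
  rw [norm_mul, norm_mul, norm_zpow, ← hϖ.zpow_mul_zpow, ← hϖ.zpow_mul_zpow]
  gcongr

lemma norm_mul_sq_le (hϖ : IsUniformizer ϖ) {t k : ℤ} (hκ : ‖κ‖ = ‖ϖ‖ ^ t) {x : F}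
    (hx : ‖x‖ ≤ ‖ϖ‖ ^ k) : ‖κ * x ^ 2‖ ≤ ‖ϖ‖ ^ (t + 2 * k) := by
  rw [norm_mul, norm_pow, hκ, two_mul, ← hϖ.zpow_mul_zpow, ← hϖ.zpow_mul_zpow, ← pow_two]
  gcongr

lemma norm_mul_sq_eq (hϖ : IsUniformizer ϖ) {t k : ℤ} (hκ : ‖κ‖ = ‖ϖ‖ ^ t) {x : F}
    (hx : ‖x‖ = ‖ϖ‖ ^ k) : ‖κ * x ^ 2‖ = ‖ϖ‖ ^ (t + 2 * k) := by
  rw [norm_mul, norm_pow, hκ, hx, two_mul, ← hϖ.zpow_mul_zpow, ← hϖ.zpow_mul_zpow, ← pow_two]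

variable [IsUltrametricDist F]

lemma admissible_subset_closedBall (hϖ : IsUniformizer ϖ) (hκ : ‖κ‖ = ‖ϖ‖ ^ (C - B))
    (hτ : ‖τ‖ ≤ ‖ϖ‖ ^ (R - r - B)) (hM : 2 * r + B + C = 2 * M + 1) (hi : i ≤ 2 * M + 1)
    (hi' : i ≤ 2 * R) :
    admissible ϖ κ τ r B C (r + C + n - i) n ⊆
      Metric.closedBall 0 (‖ϖ‖ ^ ((n : ℤ) - (min n (i / 2) : ℕ))) := by
  obtain ⟨m, hm⟩ : ∃ m : ℤ, m = r + C + n - i := ⟨_, rfl⟩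
  rw [← hm]
  rintro x ⟨hx1, -, hquad⟩
  rw [mem_closedBall_zero_iff]
  rcases eq_or_ne x 0 with rfl | hx
  · rw [norm_zero]
    exact zpow_nonneg (norm_nonneg ϖ) _
  obtain ⟨k, hk⟩ := hϖ.exists_norm_eq_zpow hx
  rw [hk, hϖ.zpow_le_one] at hx1
  rw [hk, hϖ.zpow_le_zpow]
  by_contra hlt
  have last_term := norm_mul_sq_eq hϖ hκ hk
  have dominated : ‖(ϖ ^ m) ^ 2 + τ * ϖ ^ m * x‖ < ‖κ * x ^ 2‖ := by
    refine (IsUltrametricDist.norm_add_le_max _ _).trans_lt (max_lt ?_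
      ((norm_mul_zpow_mul_le hϖ hτ hk.le).trans_lt ?_))
    · rw [norm_sq_zpow, last_term, hϖ.zpow_lt_zpow]
      omega
    · rw [last_term, hϖ.zpow_lt_zpow]
      omega
  rw [norm_sub_eq_of_lt dominated, last_term, hϖ.zpow_le_zpow] at hquad
  omega

lemma admissible_eq_closedBall (hϖ : IsUniformizer ϖ) (hκ : ‖κ‖ = ‖ϖ‖ ^ (C - B))
    (hτ : ‖τ‖ ≤ ‖ϖ‖ ^ (R - r - B)) (hM : 2 * r + B + C = 2 * M + 1) (hi : i ≤ 2 * M + 1)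
    (hi' : i ≤ 2 * R) :
    admissible ϖ κ τ r B C (r + C + n - i) n =
      Metric.closedBall 0 (‖ϖ‖ ^ ((n : ℤ) - (min n (i / 2) : ℕ))) := by
  refine (admissible_subset_closedBall hϖ hκ hτ hM hi hi').antisymm fun x hx => ?_
  rw [mem_closedBall_zero_iff] at hx
  refine ⟨hx.trans (hϖ.zpow_le_one.2 (by omega)), hx.trans (hϖ.zpow_le_zpow.2 (by omega)),
    norm_sub_le_of_norm_le (norm_add_le_of_norm_le ?_ ?_) ?_⟩
  · rw [norm_sq_zpow, hϖ.zpow_le_zpow]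
    omega
  · exact (norm_mul_zpow_mul_le hϖ hτ hx).trans (hϖ.zpow_le_zpow.2 (by omega))
  · exact (norm_mul_sq_le hϖ hκ hx).trans (hϖ.zpow_le_zpow.2 (by omega))

lemma admissible_eq_empty (hϖ : IsUniformizer ϖ) (hκ : ‖κ‖ = ‖ϖ‖ ^ (C - B))
    (hτ : ‖τ‖ ≤ ‖ϖ‖ ^ (R - r - B)) (hM : 2 * r + B + C = 2 * M + 1) (hR : M < R)
    (hi : 2 * M + 1 < i) : admissible ϖ κ τ r B C (r + C + n - i) n = ∅ := by
  refine Set.eq_empty_of_forall_notMem fun x hx => ?_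
  have hτκ : ‖τ‖ ^ 2 < ‖κ‖ := by
    calc ‖τ‖ ^ 2 ≤ ‖ϖ‖ ^ (R - r - B + (R - r - B) : ℤ) := by
          rw [← hϖ.zpow_mul_zpow, ← pow_two]
          gcongr
      _ < ‖κ‖ := by
          rw [hκ, hϖ.zpow_lt_zpow]
          omega
  have hne : ‖ϖ ^ (r + C + n - i : ℤ)‖ ^ 2 ≠ ‖κ‖ * ‖x‖ ^ 2 := by
    rw [← norm_pow, ← norm_pow, ← norm_mul, norm_sq_zpow]
    rcases eq_or_ne x 0 with rfl | hx0
    · rw [zero_pow two_ne_zero, mul_zero, norm_zero]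
      exact (zpow_pos hϖ.norm_pos _).ne'
    obtain ⟨k, hk⟩ := hϖ.exists_norm_eq_zpow hx0
    rw [norm_mul_sq_eq hϖ hκ hk, ne_eq, hϖ.zpow_inj]
    omega
  have hle := (norm_sq_le_norm_quadratic hτκ hne).trans hx.2.2
  rw [← norm_pow, norm_sq_zpow, hϖ.zpow_le_zpow] at hle
  omega

lemma admissible_eq_union [CompleteSpace F] (hϖ : IsUniformizer ϖ) (hκ : ‖κ‖ = ‖ϖ‖ ^ (C - B))
    (hτ : ‖τ‖ = ‖ϖ‖ ^ (R - r - B)) (hM : 2 * r + B + C = 2 * M + 1) (hR : R ≤ M)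
    (hi : 2 * R < i) :
    ∃ x₁ x₂ : F, ‖x₁‖ = ‖ϖ‖ ^ (2 * M + 1 - R + n - i : ℤ) ∧ ‖x₂‖ = ‖ϖ‖ ^ (R + n - i : ℤ) ∧
      ‖x₁ - x₂‖ = ‖ϖ‖ ^ (R + n - i : ℤ) ∧
      admissible ϖ κ τ r B C (r + C + n - i) n =
        Metric.closedBall 0 1 ∩ Metric.closedBall x₁ (‖ϖ‖ ^ (n - R : ℤ)) ∪
        Metric.closedBall 0 1 ∩ Metric.closedBall x₂ (‖ϖ‖ ^ (n - R : ℤ)) := by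
  obtain ⟨m, hm⟩ : ∃ m : ℤ, m = r + C + n - i := ⟨_, rfl⟩
  have hκ0 : κ ≠ 0 := norm_pos_iff.1 (hκ ▸ zpow_pos hϖ.norm_pos _)
  obtain ⟨x₁, x₂, h₁, h₂, h₁₂, hfac⟩ := exists_quadratic_eq_mul (τ := τ) hκ0 (by
    rw [hκ, hτ, pow_two, hϖ.zpow_mul_zpow, hϖ.zpow_lt_zpow]; omega) (ϖ ^ m)
  rw [norm_zpow, hτ, ← zpow_sub₀ hϖ.norm_pos.ne',
    show m - (R - r - B) = 2 * M + 1 - R + n - i by omega] at h₁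
  rw [norm_zpow, hτ, hκ, ← zpow_sub₀ hϖ.norm_pos.ne', hϖ.zpow_mul_zpow,
    show m + (R - r - B - (C - B)) = R + n - i by omega] at h₂ h₁₂
  refine ⟨x₁, x₂, h₁, h₂, h₁₂, ?_⟩
  have hexp : ‖ϖ‖ ^ (m + n - r - B : ℤ) = ‖κ‖ * (‖ϖ‖ ^ (n - R : ℤ) * ‖x₁ - x₂‖) := by
    rw [h₁₂, hκ, hϖ.zpow_mul_zpow, hϖ.zpow_mul_zpow, hϖ.zpow_inj]
    omega
  have quad_iff : ∀ x, ‖(ϖ ^ m) ^ 2 + τ * ϖ ^ m * x - κ * x ^ 2‖ ≤ ‖ϖ‖ ^ (m + n - r - B) ↔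
      ‖x - x₁‖ ≤ ‖ϖ‖ ^ (n - R : ℤ) ∨ ‖x - x₂‖ ≤ ‖ϖ‖ ^ (n - R : ℤ) := fun x => by
    rw [hexp, hfac, norm_mul, norm_neg, norm_mul, mul_le_mul_iff_right₀ (norm_pos_iff.2 hκ0)]
    refine norm_sub_mul_norm_sub_le_iff (zpow_nonneg (norm_nonneg ϖ) _) ?_ x
    rw [h₁₂, hϖ.zpow_lt_zpow]
    omega
  have norm_le_of_near : ∀ x y : F, ‖y‖ ≤ ‖ϖ‖ ^ (m - C - r) → ‖x - y‖ ≤ ‖ϖ‖ ^ (n - R : ℤ) →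
      ‖x‖ ≤ ‖ϖ‖ ^ (m - C - r) := fun x y hy hxy =>
    sub_add_cancel x y ▸ norm_add_le_of_norm_le (hxy.trans (hϖ.zpow_le_zpow.2 (by omega))) hy
  ext x
  simp only [admissible, ← hm, ← Set.inter_union_distrib_left, Set.mem_ofPred_eq, Set.mem_inter_iff,
    Set.mem_union, mem_closedBall_iff_norm, sub_zero, quad_iff]
  refine and_congr_right fun _ => and_iff_right_of_imp ?_
  rintro (h | h)
  · exact norm_le_of_near x x₁ (h₁ ▸ hϖ.zpow_le_zpow.2 (by omega)) h
  · exact norm_le_of_near x x₂ (h₂ ▸ hϖ.zpow_le_zpow.2 (by omega)) h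

lemma hasBallPartition_closedBall_inter_closedBall [ProperSpace F] (hϖ : IsUniformizer ϖ) {y : F}
    {e : ℤ} (hy : ‖y‖ = ‖ϖ‖ ^ e) (n R : ℕ) :
    HasBallPartition (‖ϖ‖ ^ (n : ℤ)) (residueCard F ^ min n R * if 0 ≤ e ∨ n - R ≤ e then 1 else 0)
      (Metric.closedBall 0 1 ∩ Metric.closedBall y (‖ϖ‖ ^ (n - R : ℤ))) := by
  split_ifs with h
  · rw [mul_one]
    rcases le_total R n with hRn | hRn
    · have hsub : Metric.closedBall y (‖ϖ‖ ^ (n - R : ℤ)) ⊆ Metric.closedBall 0 1 := by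
        have hy1 : y ∈ Metric.closedBall (0 : F) 1 :=
          mem_closedBall_zero_iff.2 (hy ▸ hϖ.zpow_le_one.2 (by omega))
        rw [IsUltrametricDist.closedBall_eq_of_mem hy1]
        exact Metric.closedBall_subset_closedBall (hϖ.zpow_le_one.2 (by omega))
      rw [Set.inter_eq_right.2 hsub, min_eq_right hRn]
      exact hasBallPartition_closedBall_zpow hϖ y n R
    · have hsub : Metric.closedBall 0 1 ⊆ Metric.closedBall y (‖ϖ‖ ^ (n - R : ℤ)) := by
        have hy0 : y ∈ Metric.closedBall (0 : F) (‖ϖ‖ ^ (n - R : ℤ)) :=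
          mem_closedBall_zero_iff.2 (hy ▸ hϖ.zpow_le_zpow.2 (by omega))
        rw [← IsUltrametricDist.closedBall_eq_of_mem hy0, ← zpow_zero ‖ϖ‖]
        exact Metric.closedBall_subset_closedBall (hϖ.zpow_le_zpow.2 (by omega))
      rw [Set.inter_eq_left.2 hsub, min_eq_left hRn]
      simpa only [sub_self, zpow_zero] using hasBallPartition_closedBall_zpow hϖ (0 : F) n n
  · suffices hempty : Metric.closedBall 0 1 ∩ Metric.closedBall y (‖ϖ‖ ^ (n - R : ℤ)) = ∅ by
      rw [mul_zero, hempty]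
      exact hasBallPartition_zero_iff.2 rfl
    refine Set.eq_empty_of_forall_notMem fun x ⟨hx, hxy⟩ => ?_
    have hlt : ‖x‖ < ‖y‖ := (mem_closedBall_zero_iff.1 hx).trans_lt (by
      rw [hy, ← zpow_zero ‖ϖ‖, hϖ.zpow_lt_zpow]; omega)
    rw [mem_closedBall_iff_norm, norm_sub_eq_of_lt hlt, hy, hϖ.zpow_le_zpow] at hxy
    omega

lemma hasBallPartition_admissible_of_lt [ProperSpace F] (hϖ : IsUniformizer ϖ)
    (hκ : ‖κ‖ = ‖ϖ‖ ^ (C - B)) (hτ : ‖τ‖ = ‖ϖ‖ ^ (R - r - B))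
    (hM : 2 * r + B + C = 2 * M + 1) (hR : R ≤ M) (hi : 2 * R < i) :
    HasBallPartition (‖ϖ‖ ^ (n : ℤ)) (classCount (residueCard F) M R n i)
      (admissible ϖ κ τ r B C (r + C + n - i) n) := by
  obtain ⟨x₁, x₂, h₁, h₂, h₁₂, heq⟩ := admissible_eq_union (n := n) hϖ hκ hτ hM hR hi
  have hdisj : Disjoint (Metric.closedBall x₁ (‖ϖ‖ ^ (n - R : ℤ)))
      (Metric.closedBall x₂ (‖ϖ‖ ^ (n - R : ℤ))) := by
    refine (IsUltrametricDist.closedBall_eq_or_disjoint _ _ _).resolve_left fun h => ?_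
    have hmem : x₁ ∈ Metric.closedBall x₂ (‖ϖ‖ ^ (n - R : ℤ)) :=
      h ▸ Metric.mem_closedBall_self (zpow_nonneg (norm_nonneg ϖ) _)
    rw [mem_closedBall_iff_norm, h₁₂, hϖ.zpow_le_zpow] at hmem
    omega
  have hcount : classCount (residueCard F) M R n i = residueCard F ^ min n R *
        (if 0 ≤ (2 * M + 1 - R + n - i : ℤ) ∨ (n - R : ℤ) ≤ 2 * M + 1 - R + n - i then 1 else 0) +
      residueCard F ^ min n R *
        (if 0 ≤ (R + n - i : ℤ) ∨ (n - R : ℤ) ≤ R + n - i then 1 else 0) := by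
    rw [classCount, if_pos hR, min_eq_right (by omega : R ≤ i / 2), ← mul_add]
    exact congrArg _ (congrArg₂ _ (if_congr (by omega) rfl rfl) (if_congr (by omega) rfl rfl))
  rw [heq, hcount]
  exact (hasBallPartition_closedBall_inter_closedBall hϖ h₁ n R).union
    (hasBallPartition_closedBall_inter_closedBall hϖ h₂ n R)
    (hdisj.mono Set.inter_subset_right Set.inter_subset_right)

lemma hasBallPartition_admissible [ProperSpace F] (hϖ : IsUniformizer ϖ)
    (hκ : ‖κ‖ = ‖ϖ‖ ^ (C - B)) (hτ : ‖τ‖ ≤ ‖ϖ‖ ^ (R - r - B))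
    (hτ' : R ≤ M → ‖τ‖ = ‖ϖ‖ ^ (R - r - B)) (hM : 2 * r + B + C = 2 * M + 1) (n i : ℕ) :
    HasBallPartition (‖ϖ‖ ^ (n : ℤ)) (classCount (residueCard F) M R n i)
      (admissible ϖ κ τ r B C (r + C + n - i) n) := by
  by_cases hsmall : i ≤ 2 * M + 1 ∧ i ≤ 2 * R
  · have hcount : classCount (residueCard F) M R n i = residueCard F ^ min n (i / 2) := by
      rw [classCount, min_eq_left (by omega : i / 2 ≤ R)]
      refine (congrArg _ ?_).trans (mul_one _)
      split_ifs <;> omega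
    rw [admissible_eq_closedBall hϖ hκ hτ hM hsmall.1 hsmall.2, hcount]
    exact hasBallPartition_closedBall_zpow hϖ 0 n (min n (i / 2))
  · rcases le_or_gt R M with hR | hR
    · exact hasBallPartition_admissible_of_lt hϖ hκ (hτ' hR) hM hR (by omega)
    · rw [admissible_eq_empty hϖ hκ hτ hM hR (by omega), classCount, if_neg (by omega),
        if_neg (by omega), mul_zero]
      exact hasBallPartition_zero_iff.2 rfl

end Admissible

section QuadraticExtension

variable {F : Type*} [NormedField F] {E : Type*} [NormedField E] [NormedAlgebra F E]

lemma isUltrametricDist_of_normedAlgebra (F E : Type*) [NormedField F] [IsUltrametricDist F]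
    [NormedField E] [NormedAlgebra F E] : IsUltrametricDist E := by
  refine IsUltrametricDist.isUltrametricDist_of_forall_norm_natCast_le_one fun n => ?_
  rw [← map_natCast (algebraMap F E) n, norm_algebraMap']
  exact IsUltrametricDist.norm_natCast_le_one F n

-- A linear map is bounded, and a bounded multiplicative map cannot increase norms.
lemma norm_algEquiv_le [CompleteSpace F] [FiniteDimensional F E] {ϖ : F} (hϖ : IsUniformizer ϖ)
    (σ : E ≃ₐ[F] E) (x : E) : ‖σ x‖ ≤ ‖x‖ := by
  let _ : NontriviallyNormedField F := NontriviallyNormedField.ofNormNeOne ⟨ϖ, hϖ.1, hϖ.2.1.ne⟩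
  let f : E →L[F] E := LinearMap.toContinuousLinearMap σ.toLinearMap
  by_contra! hlt
  have hx : 0 < ‖x‖ := norm_pos_iff.2 fun hx => by simp [hx] at hlt
  obtain ⟨n, hn⟩ := pow_unbounded_of_one_lt ‖f‖ ((one_lt_div hx).2 hlt)
  have hbound : ‖σ (x ^ n)‖ ≤ ‖f‖ * ‖x ^ n‖ := f.le_opNorm (x ^ n)
  rw [map_pow, norm_pow, norm_pow] at hbound
  rw [div_pow, lt_div_iff₀ (pow_pos hx n)] at hn
  linarith

lemma norm_algEquiv [CompleteSpace F] [FiniteDimensional F E] {ϖ : F} (hϖ : IsUniformizer ϖ)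
    (σ : E ≃ₐ[F] E) (x : E) : ‖σ x‖ = ‖x‖ := by
  refine le_antisymm (norm_algEquiv_le hϖ σ x) ?_
  simpa using norm_algEquiv_le hϖ σ.symm (σ x)

lemma exists_algebraMap_eq_of_map_eq (hE : Module.finrank F E = 2) {σ : E ≃ₐ[F] E}
    (hσ : σ ≠ 1) {y : E} (hy : σ y = y) : ∃ x : F, algebraMap F E x = y := by
  have : IsSimpleOrder (Subalgebra F E) :=
    Subalgebra.isSimpleOrder_of_finrank_prime F E (hE ▸ Nat.prime_two)
  set fixed := AlgHom.equalizer (σ : E →ₐ[F] E) (AlgHom.id F E)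
  have hmem : y ∈ fixed := hy
  rcases eq_bot_or_eq_top fixed with hbot | htop
  · rw [hbot] at hmem
    exact Algebra.mem_bot.1 hmem
  · refine absurd (AlgEquiv.ext fun z => ?_) hσ
    have hz : z ∈ fixed := htop ▸ Algebra.mem_top
    exact hz

lemma exists_eq_algebraMap_mul (hE : Module.finrank F E = 2) {σ : E ≃ₐ[F] E} (hσ : σ ≠ 1)
    {x y : E} (hy : y ≠ 0) (hxy : σ x * y = x * σ y) : ∃ t : F, x = algebraMap F E t * y := by
  obtain ⟨t, ht⟩ := exists_algebraMap_eq_of_map_eq hE hσ (y := x / y) (by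
    rw [map_div₀, div_eq_div_iff (by simpa using hy) hy, hxy])
  exact ⟨t, by rw [ht, div_mul_cancel₀ _ hy]⟩

namespace IsUnramifiedQuadratic

variable (hE : IsUnramifiedQuadratic F E) {ϖ : F} (hϖ : IsUniformizer ϖ)
include hE

lemma finiteDimensional : FiniteDimensional F E :=
  Module.finite_of_finrank_pos (hE.1 ▸ two_pos)

include hϖ

lemma norm_eq_zpow_ord {x : E} (hx : x ≠ 0) : ‖x‖ = ‖ϖ‖ ^ ord ϖ x := by
  obtain ⟨y, hy⟩ := hE.2 x
  exact hϖ.norm_eq_zpow_ord_of_norm_eq hx hy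

lemma norm_eq_of_ordTop_eq {x : E} {k : ℤ} (hx : ordTop ϖ x = k) : ‖x‖ = ‖ϖ‖ ^ k := by
  rw [ordTop] at hx
  split_ifs at hx with hx0
  · exact absurd hx WithTop.top_ne_coe
  · rw [hE.norm_eq_zpow_ord hϖ hx0, WithTop.coe_inj.1 hx]

lemma norm_le_zpow_iff (x : E) (k : ℤ) : ‖x‖ ≤ ‖ϖ‖ ^ k ↔ (k : WithTop ℤ) ≤ ordTop ϖ x := by
  rw [ordTop]
  split_ifs with hx
  · simp only [hx, norm_zero, le_top, iff_true]
    exact (zpow_pos hϖ.norm_pos k).le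
  · rw [hE.norm_eq_zpow_ord hϖ hx, hϖ.zpow_le_zpow, WithTop.coe_le_coe]

end IsUnramifiedQuadratic

lemma mem_symmetricSpace_fin_two {σ : E ≃ₐ[F] E} {a b c d : E} :
    !![a, b; c, d] ∈ symmetricSpace σ ↔
      (a * σ a + b * σ c = 1 ∧ a * σ b + b * σ d = 0) ∧
        c * σ a + d * σ c = 0 ∧ c * σ b + d * σ d = 1 := by
  rw [symmetricSpace, Set.mem_ofPred_eq, ← Matrix.ext_iff]
  simp [Matrix.mul_apply, Fin.forall_fin_two]

lemma map_mul_eq_one_of_mem_symmetricSpace {n : ℕ} {σ : E ≃ₐ[F] E}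
    {γ : Matrix (Fin n) (Fin n) E} (hγ : γ ∈ symmetricSpace σ) : γ.map σ * γ = 1 :=
  mul_eq_one_comm.1 hγ

end QuadraticExtension

namespace IsNonsplitRep

variable {F : Type*} [NormedField F] {E : Type*} [NormedField E] [NormedAlgebra F E]
  {σ : E ≃ₐ[F] E} {ϖ : F} {a b c d : E} {e : F} (h : IsNonsplitRep σ ϖ a b c d e)
include h

lemma map_mul_eq : (σ a * a + σ b * c = 1 ∧ σ a * b + σ b * d = 0) ∧
    σ c * a + σ d * c = 0 ∧ σ c * b + σ d * d = 1 := by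
  have hγ := map_mul_eq_one_of_mem_symmetricSpace h.mem_symmetricSpace
  rw [← Matrix.ext_iff] at hγ
  simpa [Matrix.mul_apply, Fin.forall_fin_two] using hγ

lemma exists_eq_algebraMap_mul (hE : Module.finrank F E = 2) (hσ : σ ≠ 1) :
    ∃ κ τ : F, c = algebraMap F E κ * b ∧ d - a = algebraMap F E τ * b := by
  obtain ⟨⟨h00, h01⟩, -, -⟩ := mem_symmetricSpace_fin_two.1 h.mem_symmetricSpace
  obtain ⟨⟨h00', h01'⟩, -, -⟩ := h.map_mul_eq
  obtain ⟨κ, hκ⟩ := SemiLieAFL.exists_eq_algebraMap_mul hE hσ (x := c) h.b_ne_zero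
    (by linear_combination h00 - h00')
  obtain ⟨τ, hτ⟩ := SemiLieAFL.exists_eq_algebraMap_mul hE hσ (x := d - a) h.b_ne_zero
    (by rw [map_sub]; linear_combination h01 - h01')
  exact ⟨κ, τ, hκ, hτ⟩

lemma norm_eq_of_eq_algebraMap_mul (hE : IsUnramifiedQuadratic F E) (hϖ : IsUniformizer ϖ)
    {x : E} {t : F} (ht : x = algebraMap F E t * b) : ‖t‖ = ‖x‖ * ‖ϖ‖ ^ (-ord ϖ b) := by
  rw [ht, norm_mul, norm_algebraMap', zpow_neg, ← hE.norm_eq_zpow_ord hϖ h.b_ne_zero,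
    mul_inv_cancel_right₀ (norm_ne_zero_iff.2 h.b_ne_zero)]

variable [CompleteSpace F] (hE : IsUnramifiedQuadratic F E) (hϖ : IsUniformizer ϖ)
include hE hϖ

lemma norm_one_sub : ‖1 - a * σ a‖ = ‖ϖ‖ ^ (ord ϖ b + ord ϖ c) := by
  have := hE.finiteDimensional
  obtain ⟨⟨h00, -⟩, -, -⟩ := mem_symmetricSpace_fin_two.1 h.mem_symmetricSpace
  rw [← h00, add_sub_cancel_left, norm_mul, norm_algEquiv hϖ,
    hE.norm_eq_zpow_ord hϖ h.b_ne_zero, hE.norm_eq_zpow_ord hϖ h.c_ne_zero, hϖ.zpow_mul_zpow]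

lemma odd_ord_add_ord : Odd (ord ϖ b + ord ϖ c) :=
  hϖ.ord_eq_of_norm_eq (h.norm_one_sub hE hϖ) ▸ h.odd_ord

variable [IsUltrametricDist F]

-- If `‖a‖ > 1` then `1 - a * σ a` has the even valuation `2 * ord a`.
lemma norm_a_le_one : ‖a‖ ≤ 1 := by
  have := hE.finiteDimensional
  have := isUltrametricDist_of_normedAlgebra F E
  by_contra! ha
  have ha0 : a ≠ 0 := norm_pos_iff.1 (zero_lt_one.trans ha)
  have hnorm : ‖a * σ a‖ = ‖ϖ‖ ^ (ord ϖ a + ord ϖ a) := by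
    rw [norm_mul, norm_algEquiv hϖ, hE.norm_eq_zpow_ord hϖ ha0, hϖ.zpow_mul_zpow]
  have hlt : ‖(1 : E)‖ < ‖a * σ a‖ := by
    rw [norm_one, norm_mul, norm_algEquiv hϖ]
    exact one_lt_mul_of_le_of_lt ha.le ha
  have hord := hϖ.ord_eq_of_norm_eq ((norm_sub_eq_of_lt hlt).trans hnorm)
  exact Int.not_odd_iff_even.2 ⟨_, hord⟩ h.odd_ord

lemma norm_d_le_one : ‖d‖ ≤ 1 := by
  have := hE.finiteDimensional
  obtain ⟨⟨-, h01⟩, -, -⟩ := h.map_mul_eq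
  have hnorm : ‖a‖ * ‖b‖ = ‖d‖ * ‖b‖ := by
    rw [← norm_algEquiv hϖ σ a, ← norm_mul, eq_neg_of_add_eq_zero_left h01, norm_neg, norm_mul,
      norm_algEquiv hϖ, mul_comm]
  rw [← mul_right_cancel₀ (norm_ne_zero_iff.2 h.b_ne_zero) hnorm]
  exact h.norm_a_le_one hE hϖ

lemma ord_add_ord_nonneg : 0 ≤ ord ϖ b + ord ϖ c := by
  have := hE.finiteDimensional
  have := isUltrametricDist_of_normedAlgebra F E
  rw [← hϖ.zpow_le_one, ← h.norm_one_sub hE hϖ]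
  refine norm_sub_le_of_norm_le norm_one.le ?_
  rw [norm_mul, norm_algEquiv hϖ]
  exact mul_le_one₀ (h.norm_a_le_one hE hϖ) (norm_nonneg _) (h.norm_a_le_one hE hϖ)

lemma ordTop_sub_nonneg : 0 ≤ ordTop ϖ (d - a) := by
  have := isUltrametricDist_of_normedAlgebra F E
  refine (hE.norm_le_zpow_iff hϖ (d - a) 0).1 ?_
  rw [zpow_zero]
  exact norm_sub_le_of_norm_le (h.norm_d_le_one hE hϖ) (h.norm_a_le_one hE hϖ)

end IsNonsplitRep

section Support

variable {F : Type*} [NormedField F] {E : Type*} [NormedField E] [NormedAlgebra F E]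
  {σ : E ≃ₐ[F] E} {ϖ : F} {r n : ℕ} {γ : Matrix (Fin n) (Fin n) E} {u v : Fin n → F}

/-- The set of all `h` for which the orbit point `(h γ h⁻¹, h u, vᵀ h⁻¹)` lies in
`K'_{S, ≤ r} × 𝓞^n × (𝓞^n)^∨`. -/
def orbitSupport (σ : E ≃ₐ[F] E) (ϖ : F) (r : ℕ) (γ : Matrix (Fin n) (Fin n) E)
    (u v : Fin n → F) : Set (Matrix.GeneralLinearGroup (Fin n) F) :=
  {h | conj h γ ∈ boundedSymmetric σ ϖ r ∧ (∀ i, ‖(h.val.mulVec u) i‖ ≤ 1) ∧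
    ∀ i, ‖(Matrix.vecMul v (h⁻¹).val) i‖ ≤ 1}

/-- The value of `η(x) |x|^{-s}` at an element `x` of valuation `k`, for a residue field of
cardinality `q`. -/
def weight (q : ℕ) (s : ℂ) (k : ℤ) : ℂ := (-1) ^ k * (((q : ℝ) ^ (-k) : ℝ) : ℂ) ^ (-s)

lemma orbIntegrand_eq_indicator [IsUltrametricDist F] (s : ℂ) :
    orbIntegrand ϖ (testFn σ ϖ r) γ u v s =
      (orbitSupport σ ϖ r γ u v).indicator
        fun h => weight (residueCard F) s (ord ϖ h.val.det) := by
  classical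
  funext h
  by_cases hγ : conj h γ ∈ boundedSymmetric σ ϖ r
  · by_cases hw : (∀ i, ‖(h.val.mulVec u) i‖ ≤ 1) ∧ ∀ i, ‖(Matrix.vecMul v (h⁻¹).val) i‖ ≤ 1
    · simp only [orbIntegrand, testFn, latticeIndicator, orbitSupport, Set.indicator_apply,
        Set.mem_ofPred_eq, hγ, hw, weight, eta, normAbs, true_and, implies_true, if_true,
        Pi.one_apply, one_mul]
    · simp only [orbIntegrand, latticeIndicator, orbitSupport, Set.indicator_apply,
        Set.mem_ofPred_eq, hw, and_false, if_false, mul_zero, zero_mul]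
  · simp only [orbIntegrand, testFn, orbitSupport, Set.indicator_apply, Set.mem_ofPred_eq, hγ,
      false_and, if_false, zero_mul]

lemma conj_mul (k h : Matrix.GeneralLinearGroup (Fin n) F) (γ : Matrix (Fin n) (Fin n) E) :
    conj (k * h) γ = conj k (conj h γ) := by
  simp only [conj, mul_inv_rev, Units.val_mul, Matrix.map_mul, mul_assoc]

lemma map_val_mul_map_val_inv (h : Matrix.GeneralLinearGroup (Fin n) F) :
    h.val.map (algebraMap F E) * (h⁻¹).val.map (algebraMap F E) = 1 := by
  rw [← Matrix.map_mul, ← Units.val_mul, mul_inv_cancel, Units.val_one,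
    Matrix.map_one _ (map_zero _) (map_one _)]

lemma conj_mem_symmetricSpace (h : Matrix.GeneralLinearGroup (Fin n) F)
    (hγ : γ ∈ symmetricSpace σ) : conj h γ ∈ symmetricSpace σ := by
  have map_map_algebraMap : ∀ A : Matrix (Fin n) (Fin n) F,
      (A.map (algebraMap F E)).map σ = A.map (algebraMap F E) := fun A => by
    ext i j
    exact σ.commutes (A i j)
  have inv_mul : (h⁻¹).val.map (algebraMap F E) * h.val.map (algebraMap F E) = 1 := by
    simpa only [inv_inv] using map_val_mul_map_val_inv (E := E) h⁻¹
  have mul_map_eq_one : γ * γ.map σ = 1 := hγ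
  change conj h γ * (conj h γ).map σ = 1
  rw [conj, Matrix.map_mul, Matrix.map_mul, map_map_algebraMap, map_map_algebraMap]
  calc _ = h.val.map (algebraMap F E) * (γ * ((h⁻¹).val.map (algebraMap F E) *
        h.val.map (algebraMap F E)) * γ.map σ) * (h⁻¹).val.map (algebraMap F E) := by
        simp only [mul_assoc]
    _ = 1 := by rw [inv_mul, mul_one, mul_map_eq_one, mul_one, map_val_mul_map_val_inv]

variable [IsUltrametricDist F]

lemma norm_mulVec_apply_le_one {A : Matrix (Fin n) (Fin n) F} (hA : ∀ i j, ‖A i j‖ ≤ 1)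
    {w : Fin n → F} (hw : ∀ i, ‖w i‖ ≤ 1) (i : Fin n) : ‖A.mulVec w i‖ ≤ 1 := by
  rw [Matrix.mulVec, dotProduct]
  refine IsUltrametricDist.norm_sum_le_of_forall_le_of_nonneg zero_le_one fun j _ => ?_
  rw [norm_mul]
  exact mul_le_one₀ (hA i j) (norm_nonneg _) (hw j)

lemma conj_mem_boundedSymmetric {k : Matrix.GeneralLinearGroup (Fin n) F}
    (hk : k ∈ integralSubgroup F n) (hγ : γ ∈ boundedSymmetric σ ϖ r) :
    conj k γ ∈ boundedSymmetric σ ϖ r := by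
  have : IsUltrametricDist E := isUltrametricDist_of_normedAlgebra F E
  refine ⟨conj_mem_symmetricSpace k hγ.1, fun i j => ?_⟩
  have smul_conj : algebraMap F E ϖ ^ r * conj k γ i j = (k.val.map (algebraMap F E) *
      (algebraMap F E ϖ ^ r • γ) * (k⁻¹).val.map (algebraMap F E)) i j := by
    rw [Matrix.mul_smul, Matrix.smul_mul, Matrix.smul_apply, smul_eq_mul, conj]
  rw [smul_conj]
  refine norm_mul_apply_le_one (norm_mul_apply_le_one (fun i j => ?_) hγ.2) (fun i j => ?_) i j
  · rw [Matrix.map_apply, norm_algebraMap']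
    exact (hk i j).1
  · rw [Matrix.map_apply, norm_algebraMap']
    exact (hk i j).2

lemma mul_mem_orbitSupport {k h : Matrix.GeneralLinearGroup (Fin n) F}
    (hk : k ∈ integralSubgroup F n) (hh : h ∈ orbitSupport σ ϖ r γ u v) :
    k * h ∈ orbitSupport σ ϖ r γ u v := by
  obtain ⟨hγ, hu, hv⟩ := hh
  refine ⟨conj_mul k h γ ▸ conj_mem_boundedSymmetric hk hγ, fun i => ?_, fun i => ?_⟩
  · rw [Units.val_mul, ← Matrix.mulVec_mulVec]
    exact norm_mulVec_apply_le_one (fun i j => (hk i j).1) hu i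
  · rw [mul_inv_rev, Units.val_mul, ← Matrix.vecMul_vecMul, ← Matrix.mulVec_transpose]
    exact norm_mulVec_apply_le_one (fun i j => (hk j i).2) hv i

lemma mul_mem_orbitSupport_iff {k h : Matrix.GeneralLinearGroup (Fin n) F}
    (hk : k ∈ integralSubgroup F n) :
    k * h ∈ orbitSupport σ ϖ r γ u v ↔ h ∈ orbitSupport σ ϖ r γ u v :=
  ⟨fun hh => inv_mul_cancel_left k h ▸ mul_mem_orbitSupport (inv_mem hk) hh,
    mul_mem_orbitSupport hk⟩

end Support

section UpperTriangular

variable {F : Type*} [NormedField F] {E : Type*} [NormedField E] [NormedAlgebra F E]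
  {σ : E ≃ₐ[F] E} {ϖ : F} {r : ℕ} {a b c d : E} {e κ τ : F}

lemma conj_upper (hκ : c = algebraMap F E κ * b) (hτ : d - a = algebraMap F E τ * b)
    (α β : Fˣ) (x : F) :
    conj (upper α β x) !![a, b; c, d] =
      !![a + algebraMap F E (x / α) * c,
        algebraMap F E (((α : F) ^ 2 + τ * α * x - κ * x ^ 2) / (α * β)) * b;
        algebraMap F E (β / α) * c, d - algebraMap F E (x / α) * c] := by
  have hα : algebraMap F E α ≠ 0 := by simp
  have hβ : algebraMap F E β ≠ 0 := by simp
  obtain rfl : d = a + algebraMap F E τ * b := by linear_combination hτ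
  subst hκ
  rw [conj, coe_upper, coe_upper_inv]
  ext i j
  fin_cases i <;> fin_cases j <;> simp [Matrix.mul_apply, Fin.sum_univ_two] <;> field_simp <;> ring

lemma upper_mulVec (α β : Fˣ) (x : F) :
    (upper α β x).val.mulVec ![0, 1] = ![x, (β : F)] := by
  ext i; fin_cases i <;> simp [coe_upper, Matrix.mulVec, dotProduct]

lemma vecMul_upper_inv (α β : Fˣ) (x : F) :
    Matrix.vecMul ![0, e] ((upper α β x)⁻¹).val = ![0, e * (β : F)⁻¹] := by
  rw [coe_upper_inv]
  ext i; fin_cases i <;> simp [Matrix.vecMul, dotProduct]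

lemma norm_algebraMap_pow_mul_algebraMap_mul_le_one_iff (hϖ : IsUniformizer ϖ) {y : E} {k m : ℤ}
    (hy : ‖y‖ = ‖ϖ‖ ^ k) {t w : F} (ht : ‖w‖ = ‖ϖ‖ ^ m) :
    ‖algebraMap F E ϖ ^ r * (algebraMap F E (t / w) * y)‖ ≤ 1 ↔ ‖t‖ ≤ ‖ϖ‖ ^ (m - k - r) := by
  rw [norm_mul, norm_mul, norm_pow, norm_algebraMap', norm_algebraMap', hy, norm_div, ht,
    ← zpow_natCast]
  have hp := hϖ.norm_pos
  rw [zpow_sub₀ hp.ne', zpow_sub₀ hp.ne', le_div_iff₀ (zpow_pos hp _), le_div_iff₀ (zpow_pos hp _),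
    ← div_le_one (zpow_pos hp m)]
  ring_nf

variable [IsUltrametricDist F]

lemma conj_upper_mem_boundedSymmetric_iff (hE : IsUnramifiedQuadratic F E)
    (hϖ : IsUniformizer ϖ) (hγ : !![a, b; c, d] ∈ symmetricSpace σ) (ha : ‖a‖ ≤ 1) (hd : ‖d‖ ≤ 1)
    (hb : b ≠ 0) (hc : c ≠ 0) (hκ : c = algebraMap F E κ * b) (hτ : d - a = algebraMap F E τ * b)
    (m n : ℤ) (x : F) :
    conj (upper (hϖ.unit ^ m) (hϖ.unit ^ n) x) !![a, b; c, d] ∈ boundedSymmetric σ ϖ r ↔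
      ‖x‖ ≤ ‖ϖ‖ ^ (m - ord ϖ c - r) ∧
        ‖(ϖ ^ m) ^ 2 + τ * ϖ ^ m * x - κ * x ^ 2‖ ≤ ‖ϖ‖ ^ (m + n - r - ord ϖ b) ∧
        m ≤ n + ord ϖ c + r := by
  have : IsUltrametricDist E := isUltrametricDist_of_normedAlgebra F E
  have norm_pow_mul_le_one : ∀ {y : E}, ‖y‖ ≤ 1 → ‖algebraMap F E ϖ ^ r * y‖ ≤ 1 := fun hy => by
    rw [norm_mul, norm_pow, norm_algebraMap']
    exact mul_le_one₀ (pow_le_one₀ (norm_nonneg ϖ) hϖ.2.1.le) (norm_nonneg _) hy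
  have add_iff : ∀ y : E, ‖algebraMap F E ϖ ^ r * (a + y)‖ ≤ 1 ↔ ‖algebraMap F E ϖ ^ r * y‖ ≤ 1 :=
    fun y => mul_add (algebraMap F E ϖ ^ r) a y ▸
      norm_add_le_iff_of_norm_le (norm_pow_mul_le_one ha)
  have sub_iff : ∀ y : E, ‖algebraMap F E ϖ ^ r * (d - y)‖ ≤ 1 ↔ ‖algebraMap F E ϖ ^ r * y‖ ≤ 1 :=
    fun y => mul_sub (algebraMap F E ϖ ^ r) d y ▸
      norm_sub_le_iff_of_norm_le (norm_pow_mul_le_one hd)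
  have hb' := hE.norm_eq_zpow_ord hϖ hb
  have hc' := hE.norm_eq_zpow_ord hϖ hc
  have hm : ‖ϖ ^ m‖ = ‖ϖ‖ ^ m := norm_zpow ϖ m
  have hmn : ‖ϖ ^ m * ϖ ^ n‖ = ‖ϖ‖ ^ (m + n) := by
    rw [norm_mul, norm_zpow, norm_zpow, hϖ.zpow_mul_zpow]
  rw [boundedSymmetric, Set.mem_ofPred_eq, and_iff_right (conj_mem_symmetricSpace _ hγ),
    conj_upper hκ hτ]
  simp only [Fin.forall_fin_two, Matrix.of_apply, Matrix.cons_val', Matrix.cons_val_zero,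
    Matrix.cons_val_one, Matrix.cons_val_fin_one, hϖ.coe_unit_zpow, add_iff, sub_iff,
    norm_algebraMap_pow_mul_algebraMap_mul_le_one_iff hϖ hc' hm,
    norm_algebraMap_pow_mul_algebraMap_mul_le_one_iff hϖ hb' hmn, norm_zpow, hϖ.zpow_le_zpow]
  rw [show m + n - ord ϖ b - r = m + n - r - ord ϖ b by ring,
    show m - ord ϖ c - r ≤ n ↔ m ≤ n + ord ϖ c + r by omega]
  tauto

lemma upper_mem_orbitSupport_iff [CompleteSpace F] (hE : IsUnramifiedQuadratic F E)
    (hϖ : IsUniformizer ϖ) (h : IsNonsplitRep σ ϖ a b c d e) (hκ : c = algebraMap F E κ * b)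
    (hτ : d - a = algebraMap F E τ * b) (m n : ℤ) (x : F) :
    upper (hϖ.unit ^ m) (hϖ.unit ^ n) x ∈
        orbitSupport σ ϖ r !![a, b; c, d] ![0, 1] ![0, e] ↔
      0 ≤ n ∧ n ≤ ord ϖ e ∧ m ≤ n + ord ϖ c + r ∧
        x ∈ admissible ϖ κ τ r (ord ϖ b) (ord ϖ c) m n := by
  have norm_mul_inv_le_one : ‖e * (ϖ ^ n)⁻¹‖ ≤ 1 ↔ n ≤ ord ϖ e := by
    rw [norm_mul, norm_inv, norm_zpow, ← div_eq_mul_inv, div_le_one (zpow_pos hϖ.norm_pos n),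
      hϖ.norm_eq_zpow_ord h.e_ne_zero, hϖ.zpow_le_zpow]
  rw [orbitSupport, Set.mem_ofPred_eq, upper_mulVec, vecMul_upper_inv,
    conj_upper_mem_boundedSymmetric_iff hE hϖ h.mem_symmetricSpace (h.norm_a_le_one hE hϖ)
      (h.norm_d_le_one hE hϖ) h.b_ne_zero h.c_ne_zero hκ hτ, hϖ.coe_unit_zpow]
  simp only [Fin.forall_fin_two, Matrix.cons_val_zero, Matrix.cons_val_one, norm_zero, zero_le_one,
    true_and, norm_zpow, hϖ.zpow_le_one, norm_mul_inv_le_one, admissible, Set.mem_ofPred_eq]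
  tauto

end UpperTriangular

section ConstantOnPieces

variable {G ι V : Type*} [MeasurableSpace G] {μ : Measure G} [NormedAddCommGroup V]
  {I : Finset ι} {A : ι → Set G} {f : G → V} {w : ι → V}

lemma integrableOn_biUnion_of_eqOn_const (hA : ∀ i, MeasurableSet (A i))
    (hμ : ∀ i ∈ I, μ (A i) ≠ ⊤) (hf : ∀ i ∈ I, Set.EqOn f (fun _ => w i) (A i)) :
    IntegrableOn f (⋃ i ∈ I, A i) μ :=
  integrableOn_finset_iUnion.2 fun i hi =>
    (integrableOn_congr_fun (hf i hi) (hA i)).2 (integrableOn_const (hμ i hi))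

lemma setIntegral_biUnion_of_eqOn_const [NormedSpace ℝ V] [CompleteSpace V]
    (hA : ∀ i, MeasurableSet (A i)) (hμ : ∀ i ∈ I, μ (A i) ≠ ⊤)
    (hdisj : Pairwise (Function.onFun Disjoint A))
    (hf : ∀ i ∈ I, Set.EqOn f (fun _ => w i) (A i)) :
    ∫ x in ⋃ i ∈ I, A i, f x ∂μ = ∑ i ∈ I, μ.real (A i) • w i := by
  rw [integral_biUnion_finset I (fun i _ => hA i) (fun i _ j _ hij => hdisj hij) fun i hi =>
    (integrableOn_congr_fun (hf i hi) (hA i)).2 (integrableOn_const (hμ i hi))]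
  refine Finset.sum_congr rfl fun i hi => ?_
  rw [setIntegral_congr_fun (hA i) (hf i hi), setIntegral_const]

end ConstantOnPieces

section OrbitCell

variable {F : Type*} [NormedField F] [IsUltrametricDist F]
  {ϖ κ τ : F} {r : ℕ} {B C : ℤ} {N : ℕ → ℕ → ℕ}

/-- The part of the orbit support in the double cosets `K * !![ϖ ^ m, x; 0, ϖ ^ n]`, where
`m + i = r + v(c) + n`, so that the determinant has valuation `r + v(c) + 2 n - i`. -/
def orbitCell (hϖ : IsUniformizer ϖ) (κ τ : F) (r : ℕ) (B C : ℤ) (p : (_ : ℕ) × ℕ) :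
    Set (Matrix.GeneralLinearGroup (Fin 2) F) :=
  cell (hϖ.unit ^ (r + C + p.1 - p.2)) (hϖ.unit ^ (p.1 : ℤ))
    (admissible ϖ κ τ r B C (r + C + p.1 - p.2) p.1)

lemma measurableSet_orbitCell (hϖ : IsUniformizer ϖ)
    [MeasurableSpace (Matrix.GeneralLinearGroup (Fin 2) F)]
    [BorelSpace (Matrix.GeneralLinearGroup (Fin 2) F)] (p : (_ : ℕ) × ℕ) :
    MeasurableSet (orbitCell hϖ κ τ r B C p) :=
  (isOpen_cell _ _ _).measurableSet

variable (hϖ : IsUniformizer ϖ)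
  (hN : ∀ n i : ℕ, HasBallPartition (‖ϖ‖ ^ (n : ℤ)) (N n i)
    (admissible ϖ κ τ r B C (r + C + n - i) n))
include hN

lemma mul_upper_mem_orbitCell_iff {k : Matrix.GeneralLinearGroup (Fin 2) F}
    (hk : k ∈ integralSubgroup F 2) (m n : ℤ) (x : F) (p : (_ : ℕ) × ℕ) :
    k * upper (hϖ.unit ^ m) (hϖ.unit ^ n) x ∈ orbitCell hϖ κ τ r B C p ↔
      m = r + C + p.1 - p.2 ∧ n = p.1 ∧ x ∈ admissible ϖ κ τ r B C m n := by
  rw [orbitCell, hϖ.mul_upper_mem_cell_iff (hN p.1 p.2) hk]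
  refine and_congr_right fun hm => and_congr_right fun hn => ?_
  rw [hm, hn]

lemma pairwise_disjoint_orbitCell :
    Pairwise (Function.onFun Disjoint (orbitCell hϖ κ τ r B C)) := by
  refine fun p p' hne => Set.disjoint_left.2 fun h hp hp' => hne ?_
  obtain ⟨k, hk, m, n, x, rfl⟩ := hϖ.exists_eq_mul_upper h
  obtain ⟨hm, hn, -⟩ := (mul_upper_mem_orbitCell_iff hϖ hN hk m n x p).1 hp
  obtain ⟨hm', hn', -⟩ := (mul_upper_mem_orbitCell_iff hϖ hN hk m n x p').1 hp'
  exact Sigma.ext (by omega) (heq_of_eq (by omega))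

lemma ord_det_of_mem_orbitCell {p : (_ : ℕ) × ℕ} {h : Matrix.GeneralLinearGroup (Fin 2) F}
    (hp : h ∈ orbitCell hϖ κ τ r B C p) : ord ϖ h.val.det = r + C + 2 * p.1 - p.2 := by
  obtain ⟨k, hk, m, n, x, rfl⟩ := hϖ.exists_eq_mul_upper h
  obtain ⟨rfl, rfl, -⟩ := (mul_upper_mem_orbitCell_iff hϖ hN hk m n x p).1 hp
  rw [hϖ.ord_det_mul_upper hk]
  ring

lemma measure_orbitCell [LocallyCompactSpace F]
    [MeasurableSpace (Matrix.GeneralLinearGroup (Fin 2) F)]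
    [BorelSpace (Matrix.GeneralLinearGroup (Fin 2) F)]
    (μ : Measure (Matrix.GeneralLinearGroup (Fin 2) F)) [μ.IsHaarMeasure] (p : (_ : ℕ) × ℕ) :
    μ (orbitCell hϖ κ τ r B C p) = N p.1 p.2 * μ (integralGL 2 F) := by
  have : Nontrivial Fˣ := ⟨hϖ.unit, 1, fun h => hϖ.2.1.ne (by
    rw [← norm_one (α := F), ← Units.val_one, ← h, IsUniformizer.unit, Units.val_mk0])⟩
  refine measure_cell μ _ ?_
  rw [hϖ.coe_unit_zpow, norm_zpow]
  exact hN p.1 p.2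

end OrbitCell

section Weight

lemma hasDerivAt_weight {q : ℕ} (hq : q ≠ 0) (k : ℤ) :
    HasDerivAt (fun s => weight q s k) ((-1) ^ k * (k * Real.log q)) 0 := by
  have zpow_pos' : (0 : ℝ) < (q : ℝ) ^ (-k) := zpow_pos (by positivity) _
  have hderiv := ((hasDerivAt_neg (0 : ℂ)).const_cpow (c := (((q : ℝ) ^ (-k) : ℝ) : ℂ))
    (Or.inl (Complex.ofReal_ne_zero.2 zpow_pos'.ne'))).const_mul ((-1 : ℂ) ^ k)
  refine hderiv.congr_deriv ?_
  rw [neg_zero, Complex.cpow_zero, one_mul, ← Complex.ofReal_log zpow_pos'.le, Real.log_zpow]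
  push_cast
  ring

lemma neg_one_zpow_add_two_mul_sub (k : ℤ) (n i : ℕ) :
    (-1 : ℂ) ^ (k + 2 * n - i) = (-1) ^ k * (-1) ^ i := by
  have neg_one_ne_zero : (-1 : ℂ) ≠ 0 := neg_ne_zero.2 one_ne_zero
  rw [zpow_sub₀ neg_one_ne_zero, zpow_add₀ neg_one_ne_zero, (even_two_mul (n : ℤ)).neg_one_zpow,
    mul_one, zpow_natCast, div_eq_mul_inv, ← inv_pow, inv_neg_one]

end Weight

section OrbitalIntegral

variable {F : Type*} [NormedField F] [IsUltrametricDist F] [ProperSpace F]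
  {E : Type*} [NormedField E] [NormedAlgebra F E]
  {σ : E ≃ₐ[F] E} {ϖ e κ τ : F} {a b c d : E} {r : ℕ} {N : ℕ → ℕ → ℕ} {L : ℕ → ℕ}

namespace IsNonsplitRep

variable (h : IsNonsplitRep σ ϖ a b c d e) (hE : IsUnramifiedQuadratic F E)
  (hϖ : IsUniformizer ϖ)
  (hκ : c = algebraMap F E κ * b) (hτ : d - a = algebraMap F E τ * b)
  (hN : ∀ n i : ℕ, HasBallPartition (‖ϖ‖ ^ (n : ℤ)) (N n i)
    (admissible ϖ κ τ r (ord ϖ b) (ord ϖ c) (r + ord ϖ c + n - i) n))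
  (hL : ∀ n i, L n ≤ i → N n i = 0)
include h hE hϖ hκ hτ hN hL

lemma orbitSupport_eq_biUnion_orbitCell :
    orbitSupport σ ϖ r !![a, b; c, d] ![0, 1] ![0, e] =
      ⋃ p ∈ (Finset.range (ord ϖ e + 1).toNat).sigma fun n => Finset.range (L n),
        orbitCell hϖ κ τ r (ord ϖ b) (ord ϖ c) p := by
  ext g
  obtain ⟨k, hk, m, n, x, rfl⟩ := hϖ.exists_eq_mul_upper g
  simp only [mul_mem_orbitSupport_iff hk, upper_mem_orbitSupport_iff hE hϖ h hκ hτ,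
    Set.mem_iUnion, exists_prop, Finset.mem_sigma, Finset.mem_range,
    mul_upper_mem_orbitCell_iff hϖ hN hk]
  constructor
  · rintro ⟨hn, hne, hm, hx⟩
    lift n to ℕ using hn
    obtain ⟨i, hi⟩ := Int.eq_ofNat_of_zero_le (show 0 ≤ r + ord ϖ c + n - m by omega)
    obtain rfl : m = r + ord ϖ c + n - i := by omega
    refine ⟨⟨n, i⟩, ⟨by dsimp only; omega, not_le.1 fun hi => ?_⟩, rfl, rfl, hx⟩
    have hempty := hN n i
    rw [hL n i hi, hasBallPartition_zero_iff] at hempty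
    exact hempty.le hx
  · rintro ⟨p, ⟨hn, -⟩, rfl, rfl, hx⟩
    exact ⟨by omega, by omega, by omega, hx⟩

variable [MeasurableSpace (Matrix.GeneralLinearGroup (Fin 2) F)]
  [BorelSpace (Matrix.GeneralLinearGroup (Fin 2) F)]
  {μ : Measure (Matrix.GeneralLinearGroup (Fin 2) F)} [μ.IsHaarMeasure]
  (hμ : μ (integralGL 2 F) = 1)
include hμ

lemma integrable_orbIntegrand_of_hasBallPartition (s : ℂ) :
    Integrable (orbIntegrand ϖ (testFn σ ϖ r) !![a, b; c, d] ![0, 1] ![0, e] s) μ := by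
  rw [orbIntegrand_eq_indicator, h.orbitSupport_eq_biUnion_orbitCell hE hϖ hκ hτ hN hL,
    integrable_indicator_iff (Finset.measurableSet_biUnion _ fun p _ =>
      measurableSet_orbitCell hϖ p)]
  refine integrableOn_biUnion_of_eqOn_const
    (w := fun p => weight (residueCard F) s (r + ord ϖ c + 2 * p.1 - p.2))
    (measurableSet_orbitCell hϖ) (fun p _ => ?_) fun p _ g hg => ?_
  · rw [measure_orbitCell hϖ hN, hμ, mul_one]
    exact ENNReal.natCast_ne_top _
  · dsimp only
    rw [ord_det_of_mem_orbitCell hϖ hN hg]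

lemma weightedOrb_eq_sum (s : ℂ) :
    weightedOrb μ ϖ (testFn σ ϖ r) !![a, b; c, d] ![0, 1] ![0, e] s =
      ∑ n ∈ Finset.range (ord ϖ e + 1).toNat, ∑ i ∈ Finset.range (L n),
        (N n i : ℂ) * weight (residueCard F) s (r + ord ϖ c + 2 * n - i) := by
  have measure_eq : ∀ p, μ (orbitCell hϖ κ τ r (ord ϖ b) (ord ϖ c) p) = N p.1 p.2 := fun p => by
    rw [measure_orbitCell hϖ hN, hμ, mul_one]
  rw [weightedOrb, orbIntegrand_eq_indicator,
    h.orbitSupport_eq_biUnion_orbitCell hE hϖ hκ hτ hN hL, integral_indicator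
      (Finset.measurableSet_biUnion _ fun p _ => measurableSet_orbitCell hϖ p),
    setIntegral_biUnion_of_eqOn_const
      (w := fun p => weight (residueCard F) s (r + ord ϖ c + 2 * p.1 - p.2))
      (measurableSet_orbitCell hϖ) (fun p _ => measure_eq p ▸ ENNReal.natCast_ne_top _)
      (pairwise_disjoint_orbitCell hϖ hN)
      (fun p _ g hg => by dsimp only; rw [ord_det_of_mem_orbitCell hϖ hN hg]),
    Finset.sum_sigma]
  simp only [measureReal_def, measure_eq, ENNReal.toReal_natCast, Complex.real_smul,
    Complex.ofReal_natCast]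

lemma hasDerivAt_weightedOrb_of_hasBallPartition :
    HasDerivAt (weightedOrb μ ϖ (testFn σ ϖ r) !![a, b; c, d] ![0, 1] ![0, e])
      ((-1) ^ (r + ord ϖ c) * Real.log (residueCard F) *
        ((∑ n ∈ Finset.range (ord ϖ e + 1).toNat, ∑ i ∈ Finset.range (L n),
          (-1) ^ i * ((r + ord ϖ c + 2 * n : ℚ) - i) * N n i : ℚ) : ℂ)) 0 := by
  have hq : residueCard F ≠ 0 := (zero_lt_one.trans one_lt_residueCard).ne'
  rw [funext (h.weightedOrb_eq_sum hE hϖ hκ hτ hN hL hμ)]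
  refine (HasDerivAt.fun_sum fun (n : ℕ) _ => HasDerivAt.fun_sum fun (i : ℕ) _ =>
    (hasDerivAt_weight hq (r + ord ϖ c + 2 * n - i)).const_mul (N n i : ℂ)).congr_deriv ?_
  simp only [neg_one_zpow_add_two_mul_sub, Rat.cast_sum, Finset.mul_sum]
  refine Finset.sum_congr rfl fun n _ => Finset.sum_congr rfl fun i _ => ?_
  push_cast
  ring

end IsNonsplitRep

end OrbitalIntegral

section TruncatedValuation

lemma exists_natCast_eq_min_add {w : WithTop ℤ} (hw : 0 ≤ w) (r M : ℕ) :
    ∃ R : ℕ, ((R : ℤ) : WithTop ℤ) = min (w + (r : ℤ)) ((M + 1 : ℕ) : ℤ) := by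
  induction w using WithTop.recTopCoe with
  | top => exact ⟨M + 1, by rw [top_add, min_eq_right le_top]⟩
  | coe k =>
    lift k to ℕ using WithTop.coe_nonneg.1 hw
    exact ⟨min (k + r) (M + 1), by push_cast; rfl⟩

variable {w : WithTop ℤ} {r M R : ℕ}
  (hR : ((R : ℤ) : WithTop ℤ) = min (w + (r : ℤ)) ((M + 1 : ℕ) : ℤ))
include hR

lemma le_add_one_of_natCast_eq_min_add : R ≤ M + 1 := by
  have hle := hR.le.trans (min_le_right _ _)
  exact_mod_cast hle

lemma coe_sub_le_of_natCast_eq_min_add : ((R - r : ℤ) : WithTop ℤ) ≤ w := by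
  induction w using WithTop.recTopCoe with
  | top => exact le_top
  | coe k =>
    have hle : (R : ℤ) ≤ k + r := by exact_mod_cast hR.le.trans (min_le_left _ _)
    exact_mod_cast sub_le_iff_le_add.2 hle

lemma eq_coe_sub_of_natCast_eq_min_add (hRM : R ≤ M) : w = ((R - r : ℤ) : WithTop ℤ) := by
  induction w using WithTop.recTopCoe with
  | top =>
    rw [top_add, min_eq_right le_top] at hR
    have : R = M + 1 := by exact_mod_cast hR
    omega
  | coe k =>
    have hmin : (R : ℤ) = min (k + r) ((M + 1 : ℕ) : ℤ) := by exact_mod_cast hR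
    exact congrArg _ (by omega)

lemma gkIndex_eq_min {vb vc : ℤ} (ve : ℤ) (hM : vb + vc + 2 * r = 2 * M + 1) :
    gkIndex r vb vc ve w = min (2 * ve) (min (2 * M + 1) (2 * R)) := by
  induction w using WithTop.recTopCoe with
  | top =>
    rw [top_add, min_eq_right le_top] at hR
    have : R = M + 1 := by exact_mod_cast hR
    change min (2 * ve) (vb + vc + 2 * r) = _
    omega
  | coe k =>
    have hmin : (R : ℤ) = min (k + r) ((M + 1 : ℕ) : ℤ) := by exact_mod_cast hR
    change min (min (2 * ve) (vb + vc + 2 * r)) (2 * k + 2 * r) = _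
    omega

end TruncatedValuation

/-- The contribution of the cells `(n, i)`, for fixed `n`, to the derivative of the orbital integral
at `s = 0`, up to the factor `(-1) ^ K * log q`; in the application `K = r + v(c) + 2 n`, so that
`K - i` is the valuation of the determinant on the cell. -/
def rowSum (q M R n : ℕ) (K : ℚ) : ℚ :=
  ∑ i ∈ Finset.range (2 * (M + 1) + n), (-1) ^ i * (K - i) * classCount q M R n i

section NonsplitOrbitalIntegral

variable {F : Type*} [NormedField F] [IsUltrametricDist F] [ProperSpace F]
  {E : Type*} [NormedField E] [NormedAlgebra F E]
  {σ : E ≃ₐ[F] E} {ϖ e : F} {a b c d : E} {r M R : ℕ}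

namespace IsNonsplitRep

variable (h : IsNonsplitRep σ ϖ a b c d e) (hE : IsUnramifiedQuadratic F E) (hσ : σ ≠ 1)
  (hϖ : IsUniformizer ϖ) (hM : ord ϖ b + ord ϖ c + 2 * r = 2 * M + 1)
  (hR : ((R : ℤ) : WithTop ℤ) = min (ordTop ϖ (d - a) + (r : ℤ)) ((M + 1 : ℕ) : ℤ))
include h hE hϖ

lemma exists_two_mul_add_one_eq (r : ℕ) :
    ∃ M : ℕ, ord ϖ b + ord ϖ c + 2 * r = 2 * M + 1 := by
  obtain ⟨A, hA⟩ := h.odd_ord_add_ord hE hϖ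
  have := h.ord_add_ord_nonneg hE hϖ
  exact ⟨(A + r).toNat, by omega⟩

include hσ hM hR

lemma exists_hasBallPartition_admissible :
    ∃ κ τ : F, c = algebraMap F E κ * b ∧ d - a = algebraMap F E τ * b ∧
      ∀ n i : ℕ, HasBallPartition (‖ϖ‖ ^ (n : ℤ)) (classCount (residueCard F) M R n i)
        (admissible ϖ κ τ r (ord ϖ b) (ord ϖ c) (r + ord ϖ c + n - i) n) := by
  obtain ⟨κ, τ, hκ, hτ⟩ := h.exists_eq_algebraMap_mul hE.1 hσ
  have norm_κ : ‖κ‖ = ‖ϖ‖ ^ (ord ϖ c - ord ϖ b) := by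
    rw [h.norm_eq_of_eq_algebraMap_mul hE hϖ hκ, hE.norm_eq_zpow_ord hϖ h.c_ne_zero,
      hϖ.zpow_mul_zpow, sub_eq_add_neg]
  have norm_τ_le : ‖τ‖ ≤ ‖ϖ‖ ^ (R - r - ord ϖ b) := by
    rw [h.norm_eq_of_eq_algebraMap_mul hE hϖ hτ, sub_eq_add_neg (_ - _), ← hϖ.zpow_mul_zpow]
    gcongr
    exact (hE.norm_le_zpow_iff hϖ _ _).2 (coe_sub_le_of_natCast_eq_min_add hR)
  have norm_τ_eq (hRM : R ≤ M) : ‖τ‖ = ‖ϖ‖ ^ (R - r - ord ϖ b) := by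
    rw [h.norm_eq_of_eq_algebraMap_mul hE hϖ hτ, sub_eq_add_neg (_ - _), ← hϖ.zpow_mul_zpow,
      hE.norm_eq_of_ordTop_eq hϖ (eq_coe_sub_of_natCast_eq_min_add hR hRM)]
  exact ⟨κ, τ, hκ, hτ, hasBallPartition_admissible hϖ norm_κ norm_τ_le norm_τ_eq (by omega)⟩

variable [MeasurableSpace (Matrix.GeneralLinearGroup (Fin 2) F)]
  [BorelSpace (Matrix.GeneralLinearGroup (Fin 2) F)]
  {μ : Measure (Matrix.GeneralLinearGroup (Fin 2) F)} [μ.IsHaarMeasure]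
  (hμ : μ (integralGL 2 F) = 1)
include hμ

lemma integrable_orbIntegrand (s : ℂ) :
    Integrable (orbIntegrand ϖ (testFn σ ϖ r) !![a, b; c, d] ![0, 1] ![0, e] s) μ := by
  obtain ⟨κ, τ, hκ, hτ, hN⟩ := h.exists_hasBallPartition_admissible hE hσ hϖ hM hR
  exact h.integrable_orbIntegrand_of_hasBallPartition hE hϖ hκ hτ hN
    (fun _ _ => classCount_eq_zero (le_add_one_of_natCast_eq_min_add hR)) hμ s

lemma hasDerivAt_weightedOrb :
    HasDerivAt (weightedOrb μ ϖ (testFn σ ϖ r) !![a, b; c, d] ![0, 1] ![0, e])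
      ((-1) ^ (r + ord ϖ c) * Real.log (residueCard F) *
        ((∑ n ∈ Finset.range (ord ϖ e + 1).toNat,
          rowSum (residueCard F) M R n (r + ord ϖ c + 2 * n) : ℚ) : ℂ)) 0 := by
  obtain ⟨κ, τ, hκ, hτ, hN⟩ := h.exists_hasBallPartition_admissible hE hσ hϖ hM hR
  exact h.hasDerivAt_weightedOrb_of_hasBallPartition hE hϖ hκ hτ hN
    (fun _ _ => classCount_eq_zero (le_add_one_of_natCast_eq_min_add hR)) hμ

end IsNonsplitRep

end NonsplitOrbitalIntegral

section GrossKeating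

open Finset

lemma sum_Icc_zero_sub_one (k : ℕ) (f : ℤ → ℚ) :
    ∑ j ∈ Icc (0 : ℤ) (k - 1), f j = ∑ j ∈ range k, f j := by
  rw [show Icc (0 : ℤ) (k - 1) = (range k).image ((↑) : ℕ → ℤ) by
    ext j; simp only [mem_Icc, mem_image, mem_range]
    exact ⟨fun hj => ⟨j.toNat, by omega⟩, by rintro ⟨i, hi, rfl⟩; omega⟩,
    sum_image fun i _ j _ => Int.ofNat_inj.1]

lemma grossKeating_two_mul (q k : ℕ) (N : ℤ) :
    grossKeating q (2 * k) (N - 2 * k) = (N - 4 * k + 1 : ℚ) / 2 * (q : ℚ) ^ k +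
      ∑ j ∈ range k, (N - 4 * j : ℚ) * (q : ℚ) ^ j := by
  rw [grossKeating, if_neg (Int.not_odd_iff_even.2 (even_two_mul _)),
    Int.mul_ediv_cancel_left _ two_ne_zero, sum_Icc_zero_sub_one, zpow_natCast]
  push_cast
  simp only [zpow_natCast, add_sub_cancel]
  ring

lemma grossKeating_two_mul_add_one (q k : ℕ) (N : ℤ) :
    grossKeating q (2 * k + 1) (N - (2 * k + 1)) =
      ∑ j ∈ range (k + 1), (N - 4 * j : ℚ) * (q : ℚ) ^ j := by
  rw [grossKeating, if_pos (odd_two_mul_add_one _),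
    show ((2 * k + 1 - 1 : ℤ)) / 2 = ((k + 1 : ℕ) : ℤ) - 1 by omega, sum_Icc_zero_sub_one]
  push_cast
  simp only [zpow_natCast, add_sub_cancel]

lemma sum_range_mul_ite_le (f : ℕ → ℚ) {X N : ℕ} (h : X < N) :
    ∑ i ∈ range N, f i * (if i ≤ X then 1 else 0) = ∑ i ∈ range (X + 1), f i := by
  simp only [mul_ite, mul_one, mul_zero]
  rw [← sum_filter]
  refine sum_congr (Finset.ext fun i => ?_) fun _ _ => rfl
  simp only [mem_filter, mem_range]
  omega

lemma sum_range_two_mul_alternating (K : ℚ) (w : ℕ → ℚ) (t : ℕ) :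
    ∑ i ∈ range (2 * t), (-1) ^ i * (K - i) * w (i / 2) = ∑ j ∈ range t, w j := by
  induction t with
  | zero => rfl
  | succ t ih =>
    rw [mul_add, mul_one, sum_range_succ, sum_range_succ, ih, sum_range_succ,
      show (2 * t + 1) / 2 = t by omega, show (2 * t) / 2 = t by omega, pow_succ, pow_mul]
    push_cast
    ring

lemma sum_range_alternating_pow_min (K x : ℚ) (R u : ℕ) :
    ∑ i ∈ range (2 * R + u), (-1) ^ i * (K - i) * x ^ min (i / 2) R =
      ∑ j ∈ range R, x ^ j +
        x ^ R * ((1 - (-1) ^ u) * (2 * K + 1 - 4 * R) + 2 * u * (-1) ^ u) / 4 := by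
  induction u with
  | zero =>
    rw [add_zero, sum_range_two_mul_alternating K (fun j => x ^ min j R),
      sum_congr rfl fun j hj => by rw [min_eq_left (mem_range.1 hj).le]]
    push_cast
    ring
  | succ u ih =>
    rw [← add_assoc, sum_range_succ, ih, min_eq_right (by omega : R ≤ (2 * R + u) / 2), pow_add,
      pow_mul]
    push_cast
    ring

lemma sum_range_pow_min (x : ℚ) {n N : ℕ} (h : n ≤ N) :
    ∑ j ∈ range N, x ^ min n j = ∑ j ∈ range n, x ^ j + (N - n) * x ^ n := by
  obtain ⟨k, rfl⟩ := Nat.exists_eq_add_of_le h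
  rw [sum_range_add, sum_congr rfl fun j hj => by rw [min_eq_right (mem_range.1 hj).le],
    sum_congr (s₁ := range k) rfl fun j _ => by rw [min_eq_left (Nat.le_add_right n j)],
    sum_const, card_range, nsmul_eq_mul]
  push_cast
  ring

section RowSum

variable {q M R n : ℕ}

lemma rowSum_of_le (hR : R ≤ M + 1) (hn : n ≤ R) (K : ℚ) :
    rowSum q M R n K = ∑ j ∈ range n, (q : ℚ) ^ j + (M + 1 - n) * (q : ℚ) ^ n := by
  have classCount_eq (i : ℕ) :
      (classCount q M R n i : ℚ) = (q : ℚ) ^ min n (i / 2) * if i ≤ 2 * M + 1 then 1 else 0 := by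
    rw [classCount, show min n (min (i / 2) R) = min n (i / 2) by omega, Nat.sub_eq_zero_of_le hn]
    simp only [add_zero, if_neg (show ¬(2 * R < i ∧ i ≤ R + n) by omega), ite_self]
    push_cast
    rfl
  simp only [rowSum, classCount_eq, ← mul_assoc]
  rw [sum_range_mul_ite_le _ (by omega), show 2 * M + 1 + 1 = 2 * (M + 1) by ring,
    sum_range_two_mul_alternating K fun j => (q : ℚ) ^ min n j, sum_range_pow_min _ (hn.trans hR)]
  push_cast
  rfl

lemma rowSum_of_lt (hn : M < n) (K : ℚ) :
    rowSum q M (M + 1) n K = ∑ j ∈ range (M + 1), (q : ℚ) ^ j := by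
  have classCount_eq (i : ℕ) : (classCount q M (M + 1) n i : ℚ) =
      (q : ℚ) ^ min (i / 2) (M + 1) * if i ≤ 2 * M + 1 then 1 else 0 := by
    rw [classCount, if_neg (by omega), min_eq_right (by omega)]
    push_cast
    rfl
  simp only [rowSum, classCount_eq, ← mul_assoc]
  rw [sum_range_mul_ite_le _ (by omega), show 2 * M + 1 + 1 = 2 * (M + 1) + 0 by ring,
    sum_range_alternating_pow_min]
  push_cast
  ring

lemma rowSum_add (hR : R ≤ M) (t : ℕ) (K : ℚ) :
    rowSum q M R (R + t) K =
      ∑ j ∈ range R, (q : ℚ) ^ j + (q : ℚ) ^ R * (1 + (-1) ^ t * (2 * M + 1 - 2 * R)) / 2 := by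
  have classCount_eq (i : ℕ) : (classCount q M R (R + t) i : ℚ) = (q : ℚ) ^ min (i / 2) R *
      ((if i ≤ 2 * M + 1 + t then 1 else 0) + (if i ≤ 2 * R + t then 1 else 0) -
        if i ≤ 2 * R then 1 else 0) := by
    rw [classCount, if_pos hR, min_eq_right (by omega : min (i / 2) R ≤ R + t), Nat.cast_mul,
      Nat.cast_pow]
    congr 1
    split_ifs <;> first | omega | norm_num
  obtain ⟨k, rfl⟩ := Nat.exists_eq_add_of_le hR
  simp only [rowSum, classCount_eq, ← mul_assoc, mul_add, mul_sub, sum_add_distrib,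
    sum_sub_distrib]
  simp only [← mul_add, ← mul_sub]
  rw [sum_range_mul_ite_le _ (by omega), sum_range_mul_ite_le _ (by omega),
    sum_range_mul_ite_le _ (by omega),
    show 2 * (R + k) + 1 + t + 1 = 2 * R + (2 * (k + 1) + t) by ring, add_assoc (2 * R),
    sum_range_alternating_pow_min, sum_range_alternating_pow_min, sum_range_alternating_pow_min,
    pow_add (-1) (2 * (k + 1)), pow_mul]
  push_cast
  ring

lemma rowSum_add_rowSum_succ (hR : R ≤ M + 1) (hn : R ≤ n) (K K' : ℚ) :
    rowSum q M R n K + rowSum q M R (n + 1) K' =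
      2 * ∑ j ∈ range R, (q : ℚ) ^ j + if R ≤ M then (q : ℚ) ^ R else 0 := by
  split_ifs with hRM
  · obtain ⟨t, rfl⟩ := Nat.exists_eq_add_of_le hn
    rw [add_assoc, rowSum_add hRM, rowSum_add hRM, pow_succ]
    ring
  · obtain rfl : R = M + 1 := by omega
    rw [rowSum_of_lt (by omega), rowSum_of_lt (by omega)]
    ring

end RowSum

section DoubledSum

variable {S : ℕ → ℚ} {R : ℕ}

lemma sum_range_add_two_add_sum_range_succ (S : ℕ → ℚ) (v : ℕ) :
    ∑ n ∈ range (v + 1 + 1), S n + ∑ n ∈ range (v + 1), S n =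
      ∑ n ∈ range (v + 1), S n + ∑ n ∈ range v, S n + (S v + S (v + 1)) := by
  linear_combination sum_range_succ S (v + 1) + sum_range_succ S v

lemma sum_range_succ_add_sum_range_of_le {x : ℚ} {M : ℕ}
    (hS : ∀ n ≤ R, S n = ∑ j ∈ range n, x ^ j + (M + 1 - n) * x ^ n) {v : ℕ} (hv : v ≤ R) :
    ∑ n ∈ range (v + 1), S n + ∑ n ∈ range v, S n =
      (M + 1 - v) * x ^ v + ∑ j ∈ range v, (2 * v + 2 * M + 1 - 4 * j) * x ^ j := by
  induction v with
  | zero =>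
    rw [sum_range_succ, hS 0 hv]
    simp only [range_zero, sum_empty, zero_add, add_zero]
  | succ v ih =>
    have coeff_succ : ∑ j ∈ range v, (2 * (v + 1 : ℕ) + 2 * M + 1 - 4 * j : ℚ) * x ^ j =
        ∑ j ∈ range v, (2 * v + 2 * M + 1 - 4 * j : ℚ) * x ^ j + 2 * ∑ j ∈ range v, x ^ j := by
      rw [mul_sum, ← sum_add_distrib]
      refine sum_congr rfl fun j _ => ?_
      push_cast
      ring
    rw [sum_range_add_two_add_sum_range_succ, ih (by omega), hS v (by omega), hS (v + 1) hv,
      sum_range_succ _ v, sum_range_succ _ v, coeff_succ]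
    push_cast
    ring

lemma sum_range_succ_add_sum_range_of_ge {γ : ℚ} (hS : ∀ n, R ≤ n → S n + S (n + 1) = γ) (t : ℕ) :
    ∑ n ∈ range (R + t + 1), S n + ∑ n ∈ range (R + t), S n =
      ∑ n ∈ range (R + 1), S n + ∑ n ∈ range R, S n + t * γ := by
  induction t with
  | zero => rw [Nat.cast_zero, zero_mul, add_zero, add_zero]
  | succ t ih =>
    rw [← add_assoc R, sum_range_add_two_add_sum_range_succ, ih, hS _ (Nat.le_add_right R t)]
    push_cast
    ring

end DoubledSum

variable {q r M R : ℕ}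

lemma sum_rowSum_add_sum_rowSum (hR : R ≤ M + 1) (v : ℕ) (K : ℕ → ℚ) :
    ∑ n ∈ range (v + 1), rowSum q M R n (K n) + ∑ n ∈ range v, rowSum q M R n (K n) =
      grossKeating q (min (2 * (v : ℤ)) (min (2 * M + 1) (2 * R)))
        (2 * v + 2 * M + 1 - min (2 * (v : ℤ)) (min (2 * M + 1) (2 * R))) := by
  have row_le (n) (hn : n ≤ R) := rowSum_of_le (q := q) hR hn (K n)
  have row_ge (n) (hn : R ≤ n) := rowSum_add_rowSum_succ (q := q) hR hn (K n) (K (n + 1))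
  by_cases hv : v ≤ R ∧ v ≤ M
  · rw [min_eq_left (by omega), grossKeating_two_mul,
      sum_range_succ_add_sum_range_of_le row_le hv.1]
    push_cast
    ring
  obtain ⟨t, rfl⟩ := Nat.exists_eq_add_of_le (by omega : R ≤ v)
  rw [sum_range_succ_add_sum_range_of_ge row_ge, sum_range_succ_add_sum_range_of_le row_le le_rfl]
  have coeff_add (k : ℕ) : ∑ j ∈ range k, (2 * R + 2 * M + 1 - 4 * j) * (q : ℚ) ^ j +
      t * (2 * ∑ j ∈ range k, (q : ℚ) ^ j) =
      ∑ j ∈ range k, ((2 * (R + t : ℕ) + 2 * M + 1 : ℤ) - 4 * j : ℚ) * (q : ℚ) ^ j := by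
    rw [mul_sum, mul_sum, ← sum_add_distrib]
    refine sum_congr rfl fun j _ => ?_
    push_cast
    ring
  rcases le_or_gt R M with hRM | hRM
  · rw [if_pos hRM, min_eq_right (b := (2 * R : ℤ)) (by omega), min_eq_right (by omega),
      grossKeating_two_mul, ← coeff_add]
    push_cast
    ring
  · obtain rfl : R = M + 1 := by omega
    rw [if_neg (by omega), min_eq_left (b := (2 * (M + 1 : ℕ) : ℤ)) (by omega),
      min_eq_right (by omega), grossKeating_two_mul_add_one, ← coeff_add]
    push_cast
    ring

lemma sum_rowSum_add_sum_rowSum_eq_GK {w : WithTop ℤ} {vb vc : ℤ}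
    (hM : vb + vc + 2 * r = 2 * M + 1)
    (hR : ((R : ℤ) : WithTop ℤ) = min (w + (r : ℤ)) ((M + 1 : ℕ) : ℤ)) (v : ℕ) (K : ℕ → ℚ) :
    ∑ n ∈ range (v + 1), rowSum q M R n (K n) + ∑ n ∈ range v, rowSum q M R n (K n) =
      GK q r vb vc v w := by
  rw [sum_rowSum_add_sum_rowSum (le_add_one_of_natCast_eq_min_add hR), GK, gkIndex_eq_min hR v hM]
  congr 2
  omega

end GrossKeating

lemma neg_one_zpow_div_mul_add {x : ℂ} (hx : x ≠ 0) (k : ℤ) (y z : ℂ) :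
    (-1) ^ k / x * ((-1) ^ k * x * y + (-1) ^ k * x * z) = y + z := by
  have sign_mul_self : (-1 : ℂ) ^ k * (-1) ^ k = 1 := by rw [← mul_zpow, neg_one_mul, neg_neg,
    one_zpow]
  rw [div_mul_eq_mul_div, div_eq_iff hx]
  linear_combination (y + z) * x * sign_mul_self

end SemiLieAFL

end

open SemiLieAFL in
theorem mainTheorem7_general
    {F : Type*} [NormedField F] [IsUltrametricDist F] [ProperSpace F]
    {E : Type*} [NormedField E] [NormedAlgebra F E] (hE : IsUnramifiedQuadratic F E)
    (σ : E ≃ₐ[F] E) (hσ : σ ≠ 1)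
    (ϖ : F) (hϖ : IsUniformizer ϖ)
    [MeasurableSpace (Matrix.GeneralLinearGroup (Fin 2) F)]
    [BorelSpace (Matrix.GeneralLinearGroup (Fin 2) F)]
    (μ : MeasureTheory.Measure (Matrix.GeneralLinearGroup (Fin 2) F)) [μ.IsHaarMeasure]
    (hμ : μ (integralGL 2 F) = 1)
    (r : ℕ)
    (a b c d : E) (e : F) (h : IsNonsplitRep σ ϖ a b c d e) (he : 0 ≤ ord ϖ e)
    (a' b' c' d' : E) (e' : F) (h' : IsNonsplitRep σ ϖ a' b' c' d' e')
    (hb' : ord ϖ b' = ord ϖ b) (hc' : ord ϖ c' = ord ϖ c) (he' : ord ϖ e' = ord ϖ e - 1)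
    (hda' : ordTop ϖ (d' - a') = ordTop ϖ (d - a)) :
    (∀ s : ℂ, MeasureTheory.Integrable
      (orbIntegrand ϖ (testFn σ ϖ r) !![a, b; c, d] ![0, 1] ![0, e] s) μ) ∧
    (∀ s : ℂ, MeasureTheory.Integrable
      (orbIntegrand ϖ (testFn σ ϖ r) !![a', b'; c', d'] ![0, 1] ![0, e'] s) μ) ∧
    DifferentiableAt ℂ (weightedOrb μ ϖ (testFn σ ϖ r) !![a, b; c, d] ![0, 1] ![0, e]) 0 ∧
    DifferentiableAt ℂ (weightedOrb μ ϖ (testFn σ ϖ r) !![a', b'; c', d'] ![0, 1] ![0, e']) 0 ∧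
    (-1 : ℂ) ^ ((r : ℤ) + ord ϖ c) / (Real.log (residueCard F) : ℂ) *
        (derivOrb μ ϖ (testFn σ ϖ r) !![a, b; c, d] ![0, 1] ![0, e] +
          derivOrb μ ϖ (testFn σ ϖ r) !![a', b'; c', d'] ![0, 1] ![0, e']) =
      (GK (residueCard F) r (ord ϖ b) (ord ϖ c) (ord ϖ e) (ordTop ϖ (d - a)) : ℂ) := by
  obtain ⟨M, hM⟩ := h.exists_two_mul_add_one_eq hE hϖ r
  obtain ⟨R, hR⟩ := exists_natCast_eq_min_add (h.ordTop_sub_nonneg hE hϖ) r M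
  obtain ⟨v, hv⟩ := Int.eq_ofNat_of_zero_le he
  have hM' : ord ϖ b' + ord ϖ c' + 2 * r = 2 * M + 1 := by rw [hb', hc', hM]
  have hR' : ((R : ℤ) : WithTop ℤ) = min (ordTop ϖ (d' - a') + (r : ℤ)) ((M + 1 : ℕ) : ℤ) := by
    rw [hda', hR]
  have hasDeriv := h.hasDerivAt_weightedOrb hE hσ hϖ hM hR hμ
  have hasDeriv' := h'.hasDerivAt_weightedOrb hE hσ hϖ hM' hR' hμ
  refine ⟨h.integrable_orbIntegrand hE hσ hϖ hM hR hμ,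
    h'.integrable_orbIntegrand hE hσ hϖ hM' hR' hμ,
    hasDeriv.differentiableAt, hasDeriv'.differentiableAt, ?_⟩
  have log_ne_zero : (Real.log (residueCard F) : ℂ) ≠ 0 :=
    Complex.ofReal_ne_zero.2 (Real.log_pos (Nat.one_lt_cast.2 one_lt_residueCard)).ne'
  rw [derivOrb, derivOrb, hasDeriv.deriv, hasDeriv'.deriv, hc',
    neg_one_zpow_div_mul_add log_ne_zero, he', hv, ← Rat.cast_add, sub_add_cancel,
    Int.toNat_natCast, Int.toNat_natCast_add_one, sum_rowSum_add_sum_rowSum_eq_GK hM hR]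

open SemiLieAFL in
theorem mainTheorem7
    {p : ℕ} [Fact p.Prime] (hp : p ≠ 2)
    {F : Type*} [NormedField F] [IsUltrametricDist F] [NormedAlgebra ℚ_[p] F]
    [FiniteDimensional ℚ_[p] F]
    {E : Type*} [NormedField E] [NormedAlgebra F E] (hE : IsUnramifiedQuadratic F E)
    (σ : E ≃ₐ[F] E) (hσ : σ ≠ 1)
    (ϖ : F) (hϖ : IsUniformizer ϖ)
    [MeasurableSpace (Matrix.GeneralLinearGroup (Fin 2) F)]
    [BorelSpace (Matrix.GeneralLinearGroup (Fin 2) F)]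
    (μ : MeasureTheory.Measure (Matrix.GeneralLinearGroup (Fin 2) F)) [μ.IsHaarMeasure]
    (hμ : μ (integralGL 2 F) = 1)
    (r : ℕ)
    (a b c d : E) (e : F) (h : IsNonsplitRep σ ϖ a b c d e) (he : 0 ≤ ord ϖ e)
    (a' b' c' d' : E) (e' : F) (h' : IsNonsplitRep σ ϖ a' b' c' d' e')
    (hb' : ord ϖ b' = ord ϖ b) (hc' : ord ϖ c' = ord ϖ c) (he' : ord ϖ e' = ord ϖ e - 1)
    (hda' : ordTop ϖ (d' - a') = ordTop ϖ (d - a)) :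
    (∀ s : ℂ, MeasureTheory.Integrable
      (orbIntegrand ϖ (testFn σ ϖ r) !![a, b; c, d] ![0, 1] ![0, e] s) μ) ∧
    (∀ s : ℂ, MeasureTheory.Integrable
      (orbIntegrand ϖ (testFn σ ϖ r) !![a', b'; c', d'] ![0, 1] ![0, e'] s) μ) ∧
    DifferentiableAt ℂ (weightedOrb μ ϖ (testFn σ ϖ r) !![a, b; c, d] ![0, 1] ![0, e]) 0 ∧
    DifferentiableAt ℂ (weightedOrb μ ϖ (testFn σ ϖ r) !![a', b'; c', d'] ![0, 1] ![0, e']) 0 ∧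
    (-1 : ℂ) ^ ((r : ℤ) + ord ϖ c) / (Real.log (residueCard F) : ℂ) *
        (derivOrb μ ϖ (testFn σ ϖ r) !![a, b; c, d] ![0, 1] ![0, e] +
          derivOrb μ ϖ (testFn σ ϖ r) !![a', b'; c', d'] ![0, 1] ![0, e']) =
      (GK (residueCard F) r (ord ϖ b) (ord ϖ c) (ord ϖ e) (ordTop ϖ (d - a)) : ℂ) := by
  have : ProperSpace F := FiniteDimensional.proper ℚ_[p] F
  exact mainTheorem7_general hE σ hσ ϖ hϖ μ hμ r a b c d e h he a' b' c' d' e' h' hb' hc' he' hda'
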